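/- Let $d_0,d_1\in\mathbb N$, let $\varepsilon>0$, and let $\mu_0,\mu_1$ be compactly supported Borel probability measures on $\mathbb R^{d_0}$ and $\mathbb R^{d_1}$. Let $\Pi(\mu_0,\mu_1)$ be the set of their couplings, let $\mathsf D_{\mathsf{KL}}$ be the Kullback–Leibler divergence, let $\|\cdot\|_F$ be the Frobenius norm, and for $A\in\mathbb R^{d_0\times d_1}$ put $$\mathsf{OT}_{A,\varepsilon}(\mu_0,\mu_1)=\inf_{\pi\in\Pi(\mu_0,\mu_1)}\int\big(-4\|x\|^2\|y\|^2-32\,x^{\intercal}Ay\big)\,d\pi(x,y)+\varepsilon\,\mathsf D_{\mathsf{KL}}(\pi\|\mu_0\otimes\mu_1).$$ This infimum is finite and is attained by exactly one coupling $\pi_A$. Put $\Phi(A)=32\|A\|_F^2+\mathsf{OT}_{A,\varepsilon}(\mu_0,\mu_1)$, and let $$\mathsf S_\varepsilon(\mu_0,\mu_1)=\inf_{\pi\in\Pi(\mu_0,\mu_1)}\int\big|\|x-x'\|^2-\|y-y'\|^2\big|^2\,d\pi\otimes\pi(x,y,x',y')+\varepsilon\,\mathsf D_{\mathsf{KL}}(\pi\|\mu_0\otimes\mu_1)$$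 be the quadratic entropic Gromov–Wasserstein (EGW) problem. Let $M_2(\mu_i)=\int\|z\|^2d\mu_i(z)$, $M_{\mu_0,\mu_1}=\sqrt{M_2(\mu_0)M_2(\mu_1)}$ and $\mathcal D_M=\{A\in\mathbb R^{d_0\times d_1}:\|A\|_F\le M/2\}$. Call $A$ a stationary point of $\Phi$ if $\Phi$ is Fréchet differentiable at $A$ with derivative $0$. Then: (i) A matrix $A\in\mathbb R^{d_0\times d_1}$ is a stationary point of $\Phi$ if and only if $A=\frac12\int xy^{\intercal}\,d\pi_A(x,y)$. The function $\Phi$ is coercive, i.e. $\Phi(A)\to\infty$ as $\|A\|_F\to\infty$; every global minimizer of $\Phi$ is a stationary point, and all stationary points, hence all minimizers, lie in $\mathcal D_{M_{\mu_0,\mu_1}}$. (ii) If $\mu_0$ and $\mu_1$ are centered (have mean zero), then a matrix $A$ minimizes $\Phi$ if and only if $\pi_A$ is optimal for $\mathsf S_\varepsilon(\mu_0,\mu_1)$ and $\frac12\int xy^{\intercal}\,d\pi_A(x,y)=A$. (iii) Suppose that $\mu_0$ and $\mu_1$ are centered. If $\mathsf S_\varepsilon(\mu_0,\mu_1)$ admits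 a unique optimal coupling $\pi_\star$, then $\Phi$ admits a unique minimizer $A^\star$, and $\pi_\star=\pi_{A^\star}$. Conversely, if $\Phi$ admits a unique minimizer $A^\star$, then $\pi_{A^\star}$ is the unique optimal coupling for $\mathsf S_\varepsilon(\mu_0,\mu_1)$. -/

import Mathlib

open MeasureTheory InformationTheory
open scoped ENNReal

attribute [local instance] Matrix.frobeniusNormedAddCommGroup Matrix.frobeniusNormedSpace

namespace EGW

noncomputable section

/-- Euclidean space of dimension `d`. -/
abbrev E (d : ℕ) : Type := EuclideanSpace ℝ (Fin d)

/-- Real matrices of size `d₀ × d₁`. Their norm is the Frobenius norm. -/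
abbrev Mat (d₀ d₁ : ℕ) : Type := Matrix (Fin d₀) (Fin d₁) ℝ

/-- The second moment of a measure. -/
def secondMoment {d : ℕ} (μ : Measure (E d)) : ℝ := ∫ x, ‖x‖ ^ 2 ∂μ

/-- A distribution with mean zero. -/
def Centered {d : ℕ} (μ : Measure (E d)) : Prop := ∫ x, x ∂μ = 0

/-- The couplings of `μ₀` and `μ₁`: the measures on the product space with these marginals. -/
def couplings {d₀ d₁ : ℕ} (μ₀ : Measure (E d₀)) (μ₁ : Measure (E d₁)) :
    Set (Measure (E d₀ × E d₁)) :=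
  {π | π.map Prod.fst = μ₀ ∧ π.map Prod.snd = μ₁}

/-- The cross-correlation matrix `∫ x yᵀ dπ(x, y)`, entry by entry. -/
def crossMoment {d₀ d₁ : ℕ} (π : Measure (E d₀ × E d₁)) : Mat d₀ d₁ :=
  Matrix.of fun i j => ∫ p, p.1 i * p.2 j ∂π

/-- The cost `c_A(x, y) = -4 ‖x‖² ‖y‖² - 32 xᵀ A y`. -/
def cost {d₀ d₁ : ℕ} (A : Mat d₀ d₁) (p : E d₀ × E d₁) : ℝ :=
  -4 * ‖p.1‖ ^ 2 * ‖p.2‖ ^ 2 - 32 * (p.1.ofLp ⬝ᵥ (A.mulVec p.2.ofLp))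

/-- The objective of the entropic optimal transport problem with cost `c_A`,
`∫ c_A dπ + ε KL(π ‖ μ₀ ⊗ μ₁)`, which is `+∞` when the divergence is infinite. -/
def eotObjective {d₀ d₁ : ℕ} (ε : ℝ) (μ₀ : Measure (E d₀)) (μ₁ : Measure (E d₁))
    (A : Mat d₀ d₁) (π : Measure (E d₀ × E d₁)) : EReal :=
  ((∫ p, cost A p ∂π : ℝ) : EReal) +
    ((ENNReal.ofReal ε * klDiv π (μ₀.prod μ₁) : ℝ≥0∞) : EReal)

/-- The entropic optimal transport value `OT_{A, ε}(μ₀, μ₁)`. -/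
def eotValue {d₀ d₁ : ℕ} (ε : ℝ) (μ₀ : Measure (E d₀)) (μ₁ : Measure (E d₁))
    (A : Mat d₀ d₁) : EReal :=
  ⨅ π ∈ couplings μ₀ μ₁, eotObjective ε μ₀ μ₁ A π

/-- `π` solves the entropic optimal transport problem `OT_{A, ε}(μ₀, μ₁)`. -/
def IsEOTOptimal {d₀ d₁ : ℕ} (ε : ℝ) (μ₀ : Measure (E d₀)) (μ₁ : Measure (E d₁))
    (A : Mat d₀ d₁) (π : Measure (E d₀ × E d₁)) : Prop :=
  π ∈ couplings μ₀ μ₁ ∧ eotObjective ε μ₀ μ₁ A π = eotValue ε μ₀ μ₁ A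

/-- The entropic optimal transport coupling `π_A`: a solution of `OT_{A, ε}(μ₀, μ₁)`.
(That there is exactly one is asserted in the theorem, not assumed.) -/
def eotCoupling {d₀ d₁ : ℕ} (ε : ℝ) (μ₀ : Measure (E d₀)) (μ₁ : Measure (E d₁))
    (A : Mat d₀ d₁) : Measure (E d₀ × E d₁) :=
  Classical.epsilon (IsEOTOptimal ε μ₀ μ₁ A)

/-- The function `Φ(A) = 32 ‖A‖_F² + OT_{A, ε}(μ₀, μ₁)`.
(That the transport value is finite is asserted in the theorem.) -/
def Phi {d₀ d₁ : ℕ} (ε : ℝ) (μ₀ : Measure (E d₀)) (μ₁ : Measure (E d₁))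
    (A : Mat d₀ d₁) : ℝ :=
  32 * ‖A‖ ^ 2 + (eotValue ε μ₀ μ₁ A).toReal

/-- `A` is a stationary point of `f`: `f` is Fréchet differentiable at `A` with derivative zero. -/
def IsStationaryPoint {d₀ d₁ : ℕ} (f : Mat d₀ d₁ → ℝ) (A : Mat d₀ d₁) : Prop :=
  HasFDerivAt f (0 : Mat d₀ d₁ →L[ℝ] ℝ) A

/-- `A` is a global minimizer of `f`. -/
def IsMinimizer {d₀ d₁ : ℕ} (f : Mat d₀ d₁ → ℝ) (A : Mat d₀ d₁) : Prop :=
  ∀ B, f A ≤ f B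

/-- The ball `D_M` of matrices of Frobenius norm at most `M / 2`. -/
def ballD (d₀ d₁ : ℕ) (M : ℝ) : Set (Mat d₀ d₁) := {A | ‖A‖ ≤ M / 2}

/-- The objective of the quadratic entropic Gromov-Wasserstein problem. -/
def egwObjective {d₀ d₁ : ℕ} (ε : ℝ) (μ₀ : Measure (E d₀)) (μ₁ : Measure (E d₁))
    (π : Measure (E d₀ × E d₁)) : ℝ≥0∞ :=
  (∫⁻ q, ENNReal.ofReal (|‖q.1.1 - q.2.1‖ ^ 2 - ‖q.1.2 - q.2.2‖ ^ 2| ^ 2) ∂(π.prod π)) +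
    ENNReal.ofReal ε * klDiv π (μ₀.prod μ₁)

/-- The quadratic entropic Gromov-Wasserstein value `S_ε(μ₀, μ₁)`. -/
def egwValue {d₀ d₁ : ℕ} (ε : ℝ) (μ₀ : Measure (E d₀)) (μ₁ : Measure (E d₁)) : ℝ≥0∞ :=
  ⨅ π ∈ couplings μ₀ μ₁, egwObjective ε μ₀ μ₁ π

/-- `π` is an optimal coupling for `S_ε(μ₀, μ₁)`. -/
def IsEGWOptimal {d₀ d₁ : ℕ} (ε : ℝ) (μ₀ : Measure (E d₀)) (μ₁ : Measure (E d₁))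
    (π : Measure (E d₀ × E d₁)) : Prop :=
  π ∈ couplings μ₀ μ₁ ∧ egwObjective ε μ₀ μ₁ π = egwValue ε μ₀ μ₁

end

end EGW

/-! Write `C(π)` for the cross-moment matrix. The transport loss is affine in `A`, with slope `-32
C(π)`, so completing the square gives `32‖A‖² + eotLoss A π = egwLoss π + 32‖A - C(π)/2‖²`
(`add_eotLoss_eq_egwLoss_add`). For centered marginals, expanding the Gromov–Wasserstein cost shows
that `egwLoss` is the EGW objective up to a constant of the marginals. Minimizing the right side
over `A` or over `π` first gives the same value, which matches minimizers of `Φ` with EGW-optimal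
couplings.

The analytic input is a quantitative strict convexity of entropy: along midpoints it gains a
multiple of the squared `L¹` distance of densities. This makes minimizing sequences Cauchy, so `π_A`
exists and is unique, and it gives quadratic growth of the loss around `π_A`
(`exists_entropicLoss_minimizer`). Cross-moments are Lipschitz in the `L¹` density, so the growth is
also quadratic in `C(π)`, with a rate that does not depend on `A` (`HasGrowth`).

Comparing the problems at `A` and `A + H` through this growth gives a first-order expansion of `Φ`
with error `O(‖H‖²)` and gradient `64 A - 32 C(π_A)`. Stationarity is thus the fixed-point equation,
and Cauchy–Schwarz on `C(π_A)` gives the ball and coercivity. -/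

namespace EGW

/-! ### Strong convexity of entropy and minimization over densities in `L¹`. -/

section EntropicMinimization

/-- This is `log t ≤ t - 1` at `t = √(m / a)`; it bounds relative entropy below by a squared
Hellinger distance. -/
theorem two_mul_sub_sqrt_mul_sqrt_le {a m : ℝ} (ha : 0 ≤ a) (hm : 0 < m) :
    2 * (a - √a * √m) ≤ a * Real.log a - a * Real.log m := by
  rcases ha.eq_or_lt with rfl | ha
  · simp
  have hs := Real.sqrt_pos.2 ha
  have hu := Real.sqrt_pos.2 hm
  have hlog : Real.log (√m / √a) ≤ √m / √a - 1 := Real.log_le_sub_one_of_pos (by positivity)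
  rw [Real.log_div hu.ne' hs.ne', Real.log_sqrt hm.le, Real.log_sqrt ha.le] at hlog
  have h2 := mul_le_mul_of_nonneg_left hlog ha.le
  have h3 : a * (√m / √a) = √a * √m := by
    field_simp
    rw [Real.sq_sqrt ha.le]
  nlinarith

/-- A quantitative form of the midpoint convexity of `klFun`. -/
theorem klFun_midpoint_add_le {a b : ℝ} (ha : 0 ≤ a) (hb : 0 ≤ b) (l : ℝ) (hl : 0 ≤ l) :
    klFun (1 / 2 * (a + b)) + (l * |a - b| - 2 * l ^ 2 * (a + b)) ≤
      1 / 2 * (klFun a + klFun b) := by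
  rcases (add_nonneg ha hb).eq_or_lt with h0 | h0
  · obtain rfl : a = 0 := by linarith
    obtain rfl : b = 0 := by linarith
    simp; linarith
  set m := 1 / 2 * (a + b) with hm
  have hm0 : 0 < m := by positivity
  have h1 := two_mul_sub_sqrt_mul_sqrt_le ha hm0
  have h2 := two_mul_sub_sqrt_mul_sqrt_le hb hm0
  -- The right side is `(√x - √m)²`. Since `|x - m| = |√x - √m| (√x + √m)`, Young's inequality with
  -- weight `l` and `(√x + √m)² ≤ 2x + 2m` give the bound.
  have key : ∀ x : ℝ, 0 ≤ x →
      2 * l * |x - m| - l ^ 2 * (2 * x + 2 * m) ≤ x + m - 2 * (√x * √m) := by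
    intro x hx
    have e1 := Real.sq_sqrt hx
    have e2 := Real.sq_sqrt hm0.le
    have e3 : |x - m| = |√x - √m| * (√x + √m) := by
      rw [← abs_of_nonneg (add_nonneg (Real.sqrt_nonneg x) (Real.sqrt_nonneg m)), ← abs_mul]
      congr 1
      nlinarith
    rw [e3]
    nlinarith [sq_nonneg (|√x - √m| - l * (√x + √m)), sq_abs (√x - √m),
      mul_nonneg (sq_nonneg l) (sq_nonneg (√x - √m))]
  have ka := key a ha
  have kb := key b hb
  have tri : |a - b| ≤ |a - m| + |b - m| := by
    rw [abs_sub_comm b m]; exact abs_sub_le a m b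
  have tri' := mul_le_mul_of_nonneg_left tri hl
  have : m * Real.log m = 1 / 2 * (a * Real.log m + b * Real.log m) := by rw [hm]; ring
  simp only [klFun_apply]
  nlinarith

variable {α : Type*} [MeasurableSpace α] {ρ : Measure α}

theorem coeFn_midpoint_ae (f g : α →₁[ρ] ℝ) :
    ∀ᵐ x ∂ρ, ((1 / 2 : ℝ) • (f + g) : α →₁[ρ] ℝ) x = 1 / 2 * (f x + g x) := by
  filter_upwards [Lp.coeFn_smul (1 / 2 : ℝ) (f + g), Lp.coeFn_add f g] with x h1 h2
  rw [h1, Pi.smul_apply, h2, Pi.add_apply, smul_eq_mul]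

theorem integrable_klFun_midpoint {f g : α →₁[ρ] ℝ} (hf : 0 ≤ᵐ[ρ] f) (hg : 0 ≤ᵐ[ρ] g)
    (hfk : Integrable (fun x ↦ klFun (f x)) ρ) (hgk : Integrable (fun x ↦ klFun (g x)) ρ) :
    Integrable (fun x ↦ klFun (((1 / 2 : ℝ) • (f + g) : α →₁[ρ] ℝ) x)) ρ := by
  refine ((hfk.add hgk).const_mul (1 / 2)).mono'
    (measurable_klFun.comp_aemeasurable (Lp.aestronglyMeasurable _).aemeasurable).aestronglyMeasurable
    ?_
  filter_upwards [coeFn_midpoint_ae f g, hf, hg] with x h h1 h2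
  simp only [Pi.zero_apply] at h1 h2
  rw [h, Real.norm_of_nonneg (klFun_nonneg (by positivity))]
  -- At `l = 0` the estimate is plain midpoint convexity, which is the domination needed.
  simpa using klFun_midpoint_add_le h1 h2 0 le_rfl

/-- The relative entropy is strongly midpoint convex for the `L¹` norm. -/
theorem integral_klFun_midpoint_add_le {f g : α →₁[ρ] ℝ} (hf : 0 ≤ᵐ[ρ] f) (hg : 0 ≤ᵐ[ρ] g)
    (hf1 : ∫ x, f x ∂ρ = 1) (hg1 : ∫ x, g x ∂ρ = 1)
    (hfk : Integrable (fun x ↦ klFun (f x)) ρ) (hgk : Integrable (fun x ↦ klFun (g x)) ρ) :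
    ∫ x, klFun (((1 / 2 : ℝ) • (f + g) : α →₁[ρ] ℝ) x) ∂ρ + ‖f - g‖ ^ 2 / 16 ≤
      1 / 2 * (∫ x, klFun (f x) ∂ρ + ∫ x, klFun (g x) ∂ρ) := by
  have hfi := L1.integrable_coeFn f
  have hgi := L1.integrable_coeFn g
  have hD : ‖f - g‖ = ∫ x, |f x - g x| ∂ρ := by
    rw [L1.norm_eq_integral_norm]
    refine integral_congr_ae ?_
    filter_upwards [Lp.coeFn_sub f g] with x hx
    rw [hx, Pi.sub_apply, Real.norm_eq_abs]
  -- With total mass `2` the gain is `l D - 4 l²` for `D = ‖f - g‖`; this `l` maximizes it, with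
  -- value `D² / 16`.
  set l := ‖f - g‖ / 8 with hl
  have hl0 : 0 ≤ l := by positivity
  have habs : Integrable (fun x ↦ |f x - g x|) ρ := (hfi.sub hgi).abs
  have hmid := integrable_klFun_midpoint hf hg hfk hgk
  have hsum : Integrable (fun x ↦ f x + g x) ρ := hfi.add hgi
  have hlow : Integrable (fun x ↦ l * |f x - g x| - 2 * l ^ 2 * (f x + g x)) ρ :=
    (habs.const_mul l).sub (hsum.const_mul _)
  have hle : ∫ x, (klFun (((1 / 2 : ℝ) • (f + g) : α →₁[ρ] ℝ) x) +
      (l * |f x - g x| - 2 * l ^ 2 * (f x + g x))) ∂ρ ≤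
      ∫ x, 1 / 2 * (klFun (f x) + klFun (g x)) ∂ρ := by
    refine integral_mono_ae (hmid.add hlow) ((hfk.add hgk).const_mul _) ?_
    filter_upwards [coeFn_midpoint_ae f g, hf, hg] with x h h1 h2
    rw [h]
    exact klFun_midpoint_add_le h1 h2 l hl0
  rw [integral_add hmid hlow, integral_sub (habs.const_mul l) (hsum.const_mul _),
    integral_const_mul, integral_const_mul, integral_const_mul, integral_add hfi hgi,
    integral_add hfk hgk, hf1, hg1, ← hD] at hle
  have : l * ‖f - g‖ - 2 * l ^ 2 * (1 + 1) = ‖f - g‖ ^ 2 / 16 := by rw [hl]; ring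
  linarith

/-- The entropic objective `∫ c f dρ + ε ∫ klFun f dρ` of a density `f`. -/
noncomputable def entropicLoss (ρ : Measure α) (c : α → ℝ) (ε : ℝ) (f : α →₁[ρ] ℝ) : ℝ :=
  ∫ x, c x * f x ∂ρ + ε * ∫ x, klFun (f x) ∂ρ

theorem integrable_bdd_mul_L1 {c : α → ℝ} {R : ℝ} (hc : AEStronglyMeasurable c ρ)
    (hR : ∀ᵐ x ∂ρ, |c x| ≤ R) (f : α →₁[ρ] ℝ) : Integrable (fun x ↦ c x * f x) ρ :=
  (L1.integrable_coeFn f).bdd_mul hc hR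

theorem integral_mul_midpoint {c : α → ℝ} {R : ℝ} (hc : AEStronglyMeasurable c ρ)
    (hR : ∀ᵐ x ∂ρ, |c x| ≤ R) (f g : α →₁[ρ] ℝ) :
    ∫ x, c x * ((1 / 2 : ℝ) • (f + g) : α →₁[ρ] ℝ) x ∂ρ =
      1 / 2 * (∫ x, c x * f x ∂ρ + ∫ x, c x * g x ∂ρ) := by
  rw [← integral_add (integrable_bdd_mul_L1 hc hR f) (integrable_bdd_mul_L1 hc hR g),
    ← integral_const_mul]
  refine integral_congr_ae ?_
  filter_upwards [coeFn_midpoint_ae f g] with x h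
  rw [h]; ring

theorem abs_integral_mul_sub_le {c : α → ℝ} {R : ℝ} (hc : AEStronglyMeasurable c ρ)
    (hR : ∀ᵐ x ∂ρ, |c x| ≤ R) (f g : α →₁[ρ] ℝ) :
    |∫ x, c x * f x ∂ρ - ∫ x, c x * g x ∂ρ| ≤ R * ‖f - g‖ := by
  rw [← integral_sub (integrable_bdd_mul_L1 hc hR f) (integrable_bdd_mul_L1 hc hR g),
    L1.norm_eq_integral_norm, ← integral_const_mul, ← Real.norm_eq_abs]
  refine norm_integral_le_of_norm_le ((L1.integrable_coeFn _).norm.const_mul R) ?_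
  filter_upwards [Lp.coeFn_sub f g, hR] with x hx h
  rw [hx, Pi.sub_apply, ← mul_sub, norm_mul, Real.norm_eq_abs]
  gcongr

theorem tendsto_integral_mul_L1 {c : α → ℝ} {R : ℝ} (hc : AEStronglyMeasurable c ρ)
    (hR : ∀ᵐ x ∂ρ, |c x| ≤ R) {F : ℕ → α →₁[ρ] ℝ} {f : α →₁[ρ] ℝ}
    (hF : Filter.Tendsto F Filter.atTop (nhds f)) :
    Filter.Tendsto (fun n ↦ ∫ x, c x * F n x ∂ρ) Filter.atTop (nhds (∫ x, c x * f x ∂ρ)) := by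
  rw [tendsto_iff_dist_tendsto_zero]
  have h := (tendsto_iff_norm_sub_tendsto_zero.1 hF).const_mul R
  rw [mul_zero] at h
  exact squeeze_zero (fun _ ↦ dist_nonneg)
    (fun n ↦ by rw [Real.dist_eq]; exact abs_integral_mul_sub_le hc hR (F n) f) h

theorem entropicLoss_midpoint_add_le {c : α → ℝ} {R ε : ℝ} (hc : AEStronglyMeasurable c ρ)
    (hR : ∀ᵐ x ∂ρ, |c x| ≤ R) (hε : 0 < ε) {f g : α →₁[ρ] ℝ}
    (hf : 0 ≤ᵐ[ρ] f) (hg : 0 ≤ᵐ[ρ] g)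
    (hf1 : ∫ x, f x ∂ρ = 1) (hg1 : ∫ x, g x ∂ρ = 1)
    (hfk : Integrable (fun x ↦ klFun (f x)) ρ) (hgk : Integrable (fun x ↦ klFun (g x)) ρ) :
    entropicLoss ρ c ε ((1 / 2 : ℝ) • (f + g)) + ε / 16 * ‖f - g‖ ^ 2 ≤
      1 / 2 * (entropicLoss ρ c ε f + entropicLoss ρ c ε g) := by
  have h := mul_le_mul_of_nonneg_left
    (integral_klFun_midpoint_add_le hf hg hf1 hg1 hfk hgk) hε.le
  unfold entropicLoss
  rw [integral_mul_midpoint hc hR]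
  nlinarith

theorem neg_le_entropicLoss {c : α → ℝ} {R ε : ℝ} (hc : AEStronglyMeasurable c ρ)
    (hR : ∀ᵐ x ∂ρ, |c x| ≤ R) (hε : 0 < ε) {f : α →₁[ρ] ℝ}
    (hf : 0 ≤ᵐ[ρ] f) (hf1 : ∫ x, f x ∂ρ = 1) : -R ≤ entropicLoss ρ c ε f := by
  have h1 : 0 ≤ ∫ x, klFun (f x) ∂ρ :=
    integral_nonneg_of_ae (hf.mono fun x hx ↦ klFun_nonneg hx)
  have h2 : ∫ x, -R * f x ∂ρ ≤ ∫ x, c x * f x ∂ρ := by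
    refine integral_mono_ae ((L1.integrable_coeFn f).const_mul _)
      (integrable_bdd_mul_L1 hc hR f) ?_
    filter_upwards [hf, hR] with x hx h
    exact mul_le_mul_of_nonneg_right (neg_le_of_abs_le h) hx
  rw [integral_const_mul, hf1] at h2
  unfold entropicLoss
  nlinarith [mul_nonneg hε.le h1]

/-- Lower semicontinuity of the entropic objective along `L¹`-convergent sequences. -/
theorem entropicLoss_le_of_tendsto {c : α → ℝ} {R ε : ℝ} (hc : AEStronglyMeasurable c ρ)
    (hR : ∀ᵐ x ∂ρ, |c x| ≤ R) (hε : 0 < ε) {F : ℕ → α →₁[ρ] ℝ} {f : α →₁[ρ] ℝ}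
    (hF : Filter.Tendsto F Filter.atTop (nhds f)) (hF0 : ∀ n, 0 ≤ᵐ[ρ] F n) (hf0 : 0 ≤ᵐ[ρ] f)
    (hFk : ∀ n, Integrable (fun x ↦ klFun (F n x)) ρ) {m : ℝ}
    (hm : Filter.Tendsto (fun n ↦ entropicLoss ρ c ε (F n)) Filter.atTop (nhds m)) :
    Integrable (fun x ↦ klFun (f x)) ρ ∧ entropicLoss ρ c ε f ≤ m := by
  -- Fatou needs pointwise convergence, available along a subsequence.
  obtain ⟨φ, hφ, hae⟩ := (tendstoInMeasure_of_tendsto_Lp hF).exists_seq_tendsto_ae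
  have hkm : ∀ g : α →₁[ρ] ℝ, AEMeasurable (fun x ↦ klFun (g x)) ρ := fun g ↦
    measurable_klFun.comp_aemeasurable (Lp.aestronglyMeasurable _).aemeasurable
  have hk0 : ∀ {g : α →₁[ρ] ℝ}, 0 ≤ᵐ[ρ] g → 0 ≤ᵐ[ρ] fun x ↦ klFun (g x) := fun hg ↦
    hg.mono fun x hx ↦ klFun_nonneg hx
  -- The linear part converges in `L¹`, so the entropies must converge to this `k`.
  set k : ℝ := (m - ∫ x, c x * f x ∂ρ) / ε with hkdef
  have hklim : Filter.Tendsto (fun n ↦ ∫ x, klFun (F (φ n) x) ∂ρ) Filter.atTop (nhds k) := by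
    have h := ((hm.sub (tendsto_integral_mul_L1 hc hR hF)).div_const ε).comp hφ.tendsto_atTop
    refine h.congr fun n ↦ ?_
    simp only [Function.comp_apply, entropicLoss]
    field_simp
    ring
  have hfat : ∫⁻ x, ENNReal.ofReal (klFun (f x)) ∂ρ ≤ ENNReal.ofReal k := by
    calc ∫⁻ x, ENNReal.ofReal (klFun (f x)) ∂ρ
        = ∫⁻ x, Filter.liminf (fun n ↦ ENNReal.ofReal (klFun (F (φ n) x))) Filter.atTop ∂ρ := by
          refine lintegral_congr_ae ?_
          filter_upwards [hae] with x hx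
          exact ((ENNReal.continuous_ofReal.comp continuous_klFun).continuousAt.tendsto.comp
            hx).liminf_eq.symm
      _ ≤ Filter.liminf (fun n ↦ ∫⁻ x, ENNReal.ofReal (klFun (F (φ n) x)) ∂ρ) Filter.atTop :=
          lintegral_liminf_le' fun n ↦ (hkm _).ennreal_ofReal
      _ = ENNReal.ofReal k := by
          refine Filter.Tendsto.liminf_eq ?_
          refine ((ENNReal.continuous_ofReal.tendsto k).comp hklim).congr fun n ↦ ?_
          exact ofReal_integral_eq_lintegral_ofReal (hFk _) (hk0 (hF0 _))
  have hint : Integrable (fun x ↦ klFun (f x)) ρ :=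
    ⟨(hkm f).aestronglyMeasurable, by
      rw [hasFiniteIntegral_iff_ofReal (hk0 hf0)]
      exact hfat.trans_lt ENNReal.ofReal_lt_top⟩
  refine ⟨hint, ?_⟩
  have hk : 0 ≤ k := ge_of_tendsto' hklim fun n ↦ integral_nonneg_of_ae (hk0 (hF0 _))
  rw [← ofReal_integral_eq_lintegral_ofReal hint (hk0 hf0), ENNReal.ofReal_le_ofReal_iff hk,
    hkdef, le_div_iff₀ hε] at hfat
  unfold entropicLoss
  linarith

/-- On a closed, midpoint convex set of probability densities in `L¹`, the entropic objective has
a minimizer, and it grows quadratically away from it. -/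
theorem exists_entropicLoss_minimizer {c : α → ℝ} {R ε : ℝ} (hc : AEStronglyMeasurable c ρ)
    (hR : ∀ᵐ x ∂ρ, |c x| ≤ R) (hε : 0 < ε) {S : Set (α →₁[ρ] ℝ)} (hS : IsClosed S)
    (hmid : ∀ f ∈ S, ∀ g ∈ S, (1 / 2 : ℝ) • (f + g) ∈ S)
    (hpos : ∀ f ∈ S, 0 ≤ᵐ[ρ] f) (hone : ∀ f ∈ S, ∫ x, f x ∂ρ = 1)
    (hne : ∃ f ∈ S, Integrable (fun x ↦ klFun (f x)) ρ) :
    ∃ f ∈ S, Integrable (fun x ↦ klFun (f x)) ρ ∧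
      ∀ g ∈ S, Integrable (fun x ↦ klFun (g x)) ρ →
        entropicLoss ρ c ε f + ε / 8 * ‖g - f‖ ^ 2 ≤ entropicLoss ρ c ε g := by
  set T : Set ℝ := entropicLoss ρ c ε '' {f | f ∈ S ∧ Integrable (fun x ↦ klFun (f x)) ρ} with hT
  have hTne : T.Nonempty := by
    obtain ⟨f, hf, hfk⟩ := hne
    exact ⟨_, f, ⟨hf, hfk⟩, rfl⟩
  have hTbdd : BddBelow T := by
    refine ⟨-R, ?_⟩
    rintro _ ⟨f, ⟨hf, -⟩, rfl⟩
    exact neg_le_entropicLoss hc hR hε (hpos f hf) (hone f hf)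
  have hinf : ∀ f ∈ S, Integrable (fun x ↦ klFun (f x)) ρ → sInf T ≤ entropicLoss ρ c ε f :=
    fun f hf hfk ↦ csInf_le hTbdd ⟨f, ⟨hf, hfk⟩, rfl⟩
  -- The midpoint stays in `S`, so its loss is at least the infimum: two near-minimizers must be
  -- close in `L¹`.
  have hgap : ∀ f ∈ S, Integrable (fun x ↦ klFun (f x)) ρ →
      ∀ g ∈ S, Integrable (fun x ↦ klFun (g x)) ρ →
      sInf T + ε / 16 * ‖f - g‖ ^ 2 ≤ 1 / 2 * (entropicLoss ρ c ε f + entropicLoss ρ c ε g) := by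
    intro f hf hfk g hg hgk
    have h1 := entropicLoss_midpoint_add_le hc hR hε (hpos f hf) (hpos g hg) (hone f hf)
      (hone g hg) hfk hgk
    have h2 := hinf _ (hmid f hf g hg)
      (integrable_klFun_midpoint (hpos f hf) (hpos g hg) hfk hgk)
    linarith
  obtain ⟨u, -, hulim, huT⟩ := exists_seq_tendsto_sInf hTne hTbdd
  choose F hF hFu using huT
  have hcau : CauchySeq F := by
    rw [Metric.cauchySeq_iff']
    intro δ hδ
    have hlt : sInf T < sInf T + ε / 16 * δ ^ 2 := by
      have : 0 < ε / 16 * δ ^ 2 := by positivity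
      linarith
    obtain ⟨N, hN⟩ := Filter.eventually_atTop.1 (hulim.eventually_lt_const hlt)
    refine ⟨N, fun n hn ↦ ?_⟩
    have h := hgap _ (hF n).1 (hF n).2 _ (hF N).1 (hF N).2
    rw [hFu, hFu] at h
    have h1 := hN n hn
    have h2 := hN N le_rfl
    rw [dist_eq_norm]
    have : ε / 16 * ‖F n - F N‖ ^ 2 < ε / 16 * δ ^ 2 := by linarith
    exact lt_of_pow_lt_pow_left₀ 2 hδ.le (lt_of_mul_lt_mul_left this (by positivity))
  obtain ⟨f, hf⟩ := cauchySeq_tendsto_of_complete hcau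
  have hfS : f ∈ S := hS.mem_of_tendsto hf (Filter.Eventually.of_forall fun n ↦ (hF n).1)
  obtain ⟨hfk, hfle⟩ := entropicLoss_le_of_tendsto hc hR hε hf (fun n ↦ hpos _ (hF n).1)
    (hpos f hfS) (fun n ↦ (hF n).2) (m := sInf T) (by simpa only [hFu] using hulim)
  refine ⟨f, hfS, hfk, fun g hg hgk ↦ ?_⟩
  -- Since `f` attains the infimum, doubling the gap inequality turns `ε / 16` into `ε / 8`.
  have h := hgap g hg hgk f hfS hfk
  have h' := hinf f hfS hfk
  linarith

end EntropicMinimization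

/-! ### Measures given by an `L¹` density, and their divergence. -/

section Density

variable {α : Type*} [MeasurableSpace α] {ρ : Measure α}

/-- The measure with density `f` with respect to `ρ`. -/
noncomputable def withL1Density (ρ : Measure α) (f : α →₁[ρ] ℝ) : Measure α :=
  ρ.withDensity fun x ↦ ENNReal.ofReal (f x)

theorem aemeasurable_ofReal_L1 (f : α →₁[ρ] ℝ) :
    AEMeasurable (fun x ↦ ENNReal.ofReal (f x)) ρ :=
  (Lp.aestronglyMeasurable f).aemeasurable.ennreal_ofReal

theorem integral_withL1Density {f : α →₁[ρ] ℝ} (hf : 0 ≤ᵐ[ρ] f) (h : α → ℝ) :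
    ∫ x, h x ∂(withL1Density ρ f) = ∫ x, h x * f x ∂ρ := by
  rw [withL1Density, integral_withDensity_eq_integral_toReal_smul₀ (aemeasurable_ofReal_L1 f)
    (Filter.Eventually.of_forall fun _ ↦ ENNReal.ofReal_lt_top)]
  refine integral_congr_ae (hf.mono fun x hx ↦ ?_)
  dsimp only
  rw [ENNReal.toReal_ofReal hx, smul_eq_mul, mul_comm]

theorem withL1Density_apply {f : α →₁[ρ] ℝ} (hf : 0 ≤ᵐ[ρ] f) {s : Set α} (hs : MeasurableSet s) :
    withL1Density ρ f s = ENNReal.ofReal (∫ x in s, f x ∂ρ) := by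
  rw [withL1Density, withDensity_apply _ hs, ofReal_integral_eq_lintegral_ofReal
    (L1.integrable_coeFn f).integrableOn (ae_restrict_of_ae hf)]

theorem rnDeriv_withL1Density [SigmaFinite ρ] {f : α →₁[ρ] ℝ} (hf : 0 ≤ᵐ[ρ] f) :
    ∀ᵐ x ∂ρ, ((withL1Density ρ f).rnDeriv ρ x).toReal = f x := by
  filter_upwards [Measure.rnDeriv_withDensity₀ ρ (aemeasurable_ofReal_L1 f), hf] with x hx h
  rw [withL1Density, hx, ENNReal.toReal_ofReal h]

theorem withL1Density_absolutelyContinuous (f : α →₁[ρ] ℝ) : withL1Density ρ f ≪ ρ :=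
  withDensity_absolutelyContinuous _ _

theorem toReal_klDiv_withL1Density [IsFiniteMeasure ρ] {f : α →₁[ρ] ℝ} (hf : 0 ≤ᵐ[ρ] f)
    [IsFiniteMeasure (withL1Density ρ f)] :
    (klDiv (withL1Density ρ f) ρ).toReal = ∫ x, klFun (f x) ∂ρ := by
  rw [toReal_klDiv_eq_integral_klFun (withL1Density_absolutelyContinuous f)]
  refine integral_congr_ae ?_
  filter_upwards [rnDeriv_withL1Density hf] with x hx
  rw [hx]

theorem klDiv_withL1Density_ne_top [IsFiniteMeasure ρ] {f : α →₁[ρ] ℝ} (hf : 0 ≤ᵐ[ρ] f)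
    [IsFiniteMeasure (withL1Density ρ f)] :
    klDiv (withL1Density ρ f) ρ ≠ ∞ ↔ Integrable (fun x ↦ klFun (f x)) ρ := by
  rw [klDiv_ne_top_iff, and_iff_right (withL1Density_absolutelyContinuous f),
    ← integrable_klFun_rnDeriv_iff (withL1Density_absolutelyContinuous f)]
  refine integrable_congr ?_
  filter_upwards [rnDeriv_withL1Density hf] with x hx
  rw [hx]

theorem exists_eq_withL1Density [SigmaFinite ρ] {π : Measure α} [IsFiniteMeasure π] (h : π ≪ ρ) :
    ∃ f : α →₁[ρ] ℝ, 0 ≤ᵐ[ρ] f ∧ π = withL1Density ρ f := by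
  have hi : Integrable (fun x ↦ (π.rnDeriv ρ x).toReal) ρ := Measure.integrable_toReal_rnDeriv
  refine ⟨hi.toL1, ?_, ?_⟩
  · filter_upwards [hi.coeFn_toL1] with x hx
    rw [hx]; exact ENNReal.toReal_nonneg
  · rw [withL1Density]
    conv_lhs => rw [← Measure.withDensity_rnDeriv_eq π ρ h]
    refine withDensity_congr_ae ?_
    filter_upwards [hi.coeFn_toL1, Measure.rnDeriv_ne_top π ρ] with x hx h
    rw [hx, ENNReal.ofReal_toReal h]

end Density

/-! ### Couplings of finite entropy as a closed convex set of densities. -/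

section Couplings

variable {d₀ d₁ : ℕ} {μ₀ : Measure (E d₀)} {μ₁ : Measure (E d₁)}

theorem isProbabilityMeasure_of_mem_couplings [IsProbabilityMeasure μ₀]
    {π : Measure (E d₀ × E d₁)} (hπ : π ∈ couplings μ₀ μ₁) : IsProbabilityMeasure π := by
  refine ⟨?_⟩
  have h := congrArg (· Set.univ) hπ.1
  simpa [Measure.map_apply measurable_fst MeasurableSet.univ] using h

theorem prod_mem_couplings [IsProbabilityMeasure μ₀] [IsProbabilityMeasure μ₁] :
    μ₀.prod μ₁ ∈ couplings μ₀ μ₁ := by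
  constructor <;> simp

theorem ae_norm_le_of_mem_couplings {R : ℝ} (h₀ : ∀ᵐ x ∂μ₀, ‖x‖ ≤ R) (h₁ : ∀ᵐ y ∂μ₁, ‖y‖ ≤ R)
    {π : Measure (E d₀ × E d₁)} (hπ : π ∈ couplings μ₀ μ₁) :
    ∀ᵐ p ∂π, ‖p.1‖ ≤ R ∧ ‖p.2‖ ≤ R := by
  rw [← hπ.1] at h₀
  rw [← hπ.2] at h₁
  exact (ae_of_ae_map measurable_fst.aemeasurable h₀).and
    (ae_of_ae_map measurable_snd.aemeasurable h₁)

/-- Continuous functions are almost surely bounded under every coupling of boundedly supported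
measures, with a common bound. -/
theorem exists_ae_bound_of_continuous {R : ℝ} (h₀ : ∀ᵐ x ∂μ₀, ‖x‖ ≤ R) (h₁ : ∀ᵐ y ∂μ₁, ‖y‖ ≤ R)
    {h : E d₀ × E d₁ → ℝ} (hh : Continuous h) :
    ∃ K, ∀ π ∈ couplings μ₀ μ₁, ∀ᵐ p ∂π, |h p| ≤ K := by
  obtain ⟨K, hK⟩ := ((isCompact_closedBall (0 : E d₀) R).prod
    (isCompact_closedBall (0 : E d₁) R)).exists_bound_of_continuousOn hh.continuousOn
  refine ⟨K, fun π hπ ↦ ?_⟩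
  filter_upwards [ae_norm_le_of_mem_couplings h₀ h₁ hπ] with p hp
  exact hK p ⟨by simpa using hp.1, by simpa using hp.2⟩

theorem integrable_of_continuous_of_mem_couplings [IsProbabilityMeasure μ₀] {R : ℝ}
    (h₀ : ∀ᵐ x ∂μ₀, ‖x‖ ≤ R) (h₁ : ∀ᵐ y ∂μ₁, ‖y‖ ≤ R)
    {h : E d₀ × E d₁ → ℝ} (hh : Continuous h) {π : Measure (E d₀ × E d₁)}
    (hπ : π ∈ couplings μ₀ μ₁) : Integrable h π := by
  have := isProbabilityMeasure_of_mem_couplings hπ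
  obtain ⟨K, hK⟩ := exists_ae_bound_of_continuous h₀ h₁ hh
  exact Integrable.of_bound hh.aestronglyMeasurable K (hK π hπ)

/-- The couplings with finite relative entropy. -/
def finCouplings (μ₀ : Measure (E d₀)) (μ₁ : Measure (E d₁)) : Set (Measure (E d₀ × E d₁)) :=
  {π | π ∈ couplings μ₀ μ₁ ∧ klDiv π (μ₀.prod μ₁) ≠ ∞}

/-- The entropic transport objective as a real number. -/
noncomputable def eotLoss (ε : ℝ) (μ₀ : Measure (E d₀)) (μ₁ : Measure (E d₁)) (A : Mat d₀ d₁)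
    (π : Measure (E d₀ × E d₁)) : ℝ :=
  ∫ p, cost A p ∂π + ε * (klDiv π (μ₀.prod μ₁)).toReal

/-- The densities of the couplings with respect to the product measure. -/
def couplingDensities (μ₀ : Measure (E d₀)) (μ₁ : Measure (E d₁)) :
    Set (E d₀ × E d₁ →₁[μ₀.prod μ₁] ℝ) :=
  {f | 0 ≤ f ∧
    (∀ s, MeasurableSet s → ∫ p in Prod.fst ⁻¹' s, f p ∂(μ₀.prod μ₁) = μ₀.real s) ∧
    (∀ s, MeasurableSet s → ∫ p in Prod.snd ⁻¹' s, f p ∂(μ₀.prod μ₁) = μ₁.real s)}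

/-- Each marginal condition equates a set integral, continuous on `L¹`, with a constant;
nonnegativity is a closed order condition. -/
theorem isClosed_couplingDensities : IsClosed (couplingDensities μ₀ μ₁) := by
  simp only [couplingDensities, Set.ofPred_and, Set.ofPred_forall]
  refine isClosed_Ici.inter (IsClosed.inter ?_ ?_) <;>
  exact isClosed_iInter fun s ↦ isClosed_iInter fun _ ↦
    isClosed_eq (continuous_setIntegral _) continuous_const

theorem coeFn_nonneg_of_mem_couplingDensities {f : E d₀ × E d₁ →₁[μ₀.prod μ₁] ℝ}
    (hf : f ∈ couplingDensities μ₀ μ₁) : 0 ≤ᵐ[μ₀.prod μ₁] f :=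
  (Lp.coeFn_nonneg f).2 hf.1

theorem integral_of_mem_couplingDensities [IsProbabilityMeasure μ₀]
    {f : E d₀ × E d₁ →₁[μ₀.prod μ₁] ℝ}
    (hf : f ∈ couplingDensities μ₀ μ₁) : ∫ p, f p ∂(μ₀.prod μ₁) = 1 := by
  simpa using hf.2.1 Set.univ MeasurableSet.univ

theorem midpoint_mem_couplingDensities {f g : E d₀ × E d₁ →₁[μ₀.prod μ₁] ℝ}
    (hf : f ∈ couplingDensities μ₀ μ₁) (hg : g ∈ couplingDensities μ₀ μ₁) :
    (1 / 2 : ℝ) • (f + g) ∈ couplingDensities μ₀ μ₁ := by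
  have key : ∀ s, ∫ p in s, ((1 / 2 : ℝ) • (f + g) : E d₀ × E d₁ →₁[μ₀.prod μ₁] ℝ) p
      ∂(μ₀.prod μ₁) = 1 / 2 * (∫ p in s, f p ∂(μ₀.prod μ₁) + ∫ p in s, g p ∂(μ₀.prod μ₁)) := by
    intro s
    rw [← integral_add (L1.integrable_coeFn f).integrableOn (L1.integrable_coeFn g).integrableOn,
      ← integral_const_mul]
    exact integral_congr_ae (ae_restrict_of_ae (coeFn_midpoint_ae f g))
  refine ⟨?_, fun s hs ↦ ?_, fun s hs ↦ ?_⟩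
  · rw [← Lp.coeFn_nonneg]
    filter_upwards [coeFn_midpoint_ae f g, coeFn_nonneg_of_mem_couplingDensities hf,
      coeFn_nonneg_of_mem_couplingDensities hg] with p hp h1 h2
    rw [hp]
    simp only [Pi.zero_apply] at h1 h2 ⊢
    positivity
  · rw [key, hf.2.1 s hs, hg.2.1 s hs]; ring
  · rw [key, hf.2.2 s hs, hg.2.2 s hs]; ring

theorem withL1Density_mem_couplings_iff [IsFiniteMeasure μ₀] [IsFiniteMeasure μ₁]
    {f : E d₀ × E d₁ →₁[μ₀.prod μ₁] ℝ} (hf : 0 ≤ᵐ[μ₀.prod μ₁] f) :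
    withL1Density (μ₀.prod μ₁) f ∈ couplings μ₀ μ₁ ↔ f ∈ couplingDensities μ₀ μ₁ := by
  have hnn : ∀ s, 0 ≤ ∫ p in s, f p ∂(μ₀.prod μ₁) := fun s ↦
    integral_nonneg_of_ae (ae_restrict_of_ae hf)
  have hle : 0 ≤ f := (Lp.coeFn_nonneg f).1 hf
  have e0 : (withL1Density (μ₀.prod μ₁) f).map Prod.fst = μ₀ ↔
      ∀ s, MeasurableSet s → ∫ p in Prod.fst ⁻¹' s, f p ∂(μ₀.prod μ₁) = μ₀.real s := by
    rw [Measure.ext_iff]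
    refine forall₂_congr fun s hs ↦ ?_
    rw [Measure.map_apply measurable_fst hs, withL1Density_apply hf (measurable_fst hs),
      measureReal_def, ← ENNReal.toReal_eq_toReal_iff' ENNReal.ofReal_ne_top (measure_ne_top _ _),
      ENNReal.toReal_ofReal (hnn _)]
  have e1 : (withL1Density (μ₀.prod μ₁) f).map Prod.snd = μ₁ ↔
      ∀ s, MeasurableSet s → ∫ p in Prod.snd ⁻¹' s, f p ∂(μ₀.prod μ₁) = μ₁.real s := by
    rw [Measure.ext_iff]
    refine forall₂_congr fun s hs ↦ ?_
    rw [Measure.map_apply measurable_snd hs, withL1Density_apply hf (measurable_snd hs),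
      measureReal_def, ← ENNReal.toReal_eq_toReal_iff' ENNReal.ofReal_ne_top (measure_ne_top _ _),
      ENNReal.toReal_ofReal (hnn _)]
  exact (and_congr e0 e1).trans (and_iff_right hle).symm

/-- Finite divergence forces absolute continuity, so Radon–Nikodym moves the minimization into `L¹`.
-/
theorem mem_finCouplings_iff [IsProbabilityMeasure μ₀] [IsProbabilityMeasure μ₁]
    {π : Measure (E d₀ × E d₁)} :
    π ∈ finCouplings μ₀ μ₁ ↔ ∃ f ∈ couplingDensities μ₀ μ₁,
      Integrable (fun p ↦ klFun (f p)) (μ₀.prod μ₁) ∧ π = withL1Density (μ₀.prod μ₁) f := by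
  constructor
  · rintro ⟨hπ, hkl⟩
    have := isProbabilityMeasure_of_mem_couplings hπ
    obtain ⟨f, hf, rfl⟩ := exists_eq_withL1Density (klDiv_ne_top_iff.1 hkl).1
    exact ⟨f, (withL1Density_mem_couplings_iff hf).1 hπ,
      (klDiv_withL1Density_ne_top hf).1 hkl, rfl⟩
  · rintro ⟨f, hf, hfk, rfl⟩
    have hf0 := coeFn_nonneg_of_mem_couplingDensities hf
    have hπ := (withL1Density_mem_couplings_iff hf0).2 hf
    have := isProbabilityMeasure_of_mem_couplings hπ
    exact ⟨hπ, (klDiv_withL1Density_ne_top hf0).2 hfk⟩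

theorem eotLoss_withL1Density [IsProbabilityMeasure μ₀] [IsProbabilityMeasure μ₁] (ε : ℝ)
    (A : Mat d₀ d₁) {f : E d₀ × E d₁ →₁[μ₀.prod μ₁] ℝ} (hf : f ∈ couplingDensities μ₀ μ₁) :
    eotLoss ε μ₀ μ₁ A (withL1Density (μ₀.prod μ₁) f) =
      entropicLoss (μ₀.prod μ₁) (cost A) ε f := by
  have hf0 := coeFn_nonneg_of_mem_couplingDensities hf
  have := isProbabilityMeasure_of_mem_couplings ((withL1Density_mem_couplings_iff hf0).2 hf)
  rw [eotLoss, integral_withL1Density hf0, toReal_klDiv_withL1Density hf0, entropicLoss]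

theorem prod_mem_finCouplings [IsProbabilityMeasure μ₀] [IsProbabilityMeasure μ₁] :
    μ₀.prod μ₁ ∈ finCouplings μ₀ μ₁ :=
  ⟨prod_mem_couplings, by simp⟩

theorem frobenius_norm_sq (A : Mat d₀ d₁) : ‖A‖ ^ 2 = ∑ i, ∑ j, A i j ^ 2 := by
  rw [Matrix.frobenius_norm_def, ← Real.sqrt_eq_rpow, Real.sq_sqrt (by positivity)]
  simp

theorem continuous_cost (A : Mat d₀ d₁) : Continuous (cost A) := by
  unfold cost dotProduct Matrix.mulVec dotProduct
  fun_prop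

theorem crossMoment_apply (π : Measure (E d₀ × E d₁)) (i : Fin d₀) (j : Fin d₁) :
    crossMoment π i j = ∫ p, p.1 i * p.2 j ∂π := rfl

/-- Each entry integrates a function bounded by `R * R` against the density, hence is Lipschitz for
the `L¹` norm. The `+ 1` in the witness only keeps the constant positive. -/
theorem exists_crossMoment_sub_le [IsProbabilityMeasure μ₀] [IsProbabilityMeasure μ₁] {R : ℝ}
    (h₀ : ∀ᵐ x ∂μ₀, ‖x‖ ≤ R) (h₁ : ∀ᵐ y ∂μ₁, ‖y‖ ≤ R) :
    ∃ K, 0 < K ∧ ∀ f ∈ couplingDensities μ₀ μ₁, ∀ g ∈ couplingDensities μ₀ μ₁,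
      ‖crossMoment (withL1Density (μ₀.prod μ₁) f) -
        crossMoment (withL1Density (μ₀.prod μ₁) g)‖ ^ 2 ≤ K * ‖f - g‖ ^ 2 := by
  refine ⟨d₀ * d₁ * (R * R) ^ 2 + 1, by positivity, fun f hf g hg ↦ ?_⟩
  have hentry : ∀ i j, (crossMoment (withL1Density (μ₀.prod μ₁) f) i j -
      crossMoment (withL1Density (μ₀.prod μ₁) g) i j) ^ 2 ≤ (R * R * ‖f - g‖) ^ 2 := by
    intro i j
    rw [crossMoment_apply, crossMoment_apply,
      integral_withL1Density (coeFn_nonneg_of_mem_couplingDensities hf),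
      integral_withL1Density (coeFn_nonneg_of_mem_couplingDensities hg)]
    refine sq_le_sq' (neg_le_of_abs_le ?_) (le_of_abs_le ?_) <;>
    · refine abs_integral_mul_sub_le (Continuous.aestronglyMeasurable (by fun_prop)) ?_ f g
      filter_upwards [ae_norm_le_of_mem_couplings h₀ h₁ prod_mem_couplings] with p hp
      rw [abs_mul]
      have hR : 0 ≤ R := (norm_nonneg _).trans hp.1
      exact mul_le_mul ((PiLp.norm_apply_le p.1 i).trans hp.1)
        ((PiLp.norm_apply_le p.2 j).trans hp.2) (abs_nonneg _) hR
  rw [frobenius_norm_sq]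
  calc ∑ i, ∑ j, (crossMoment (withL1Density (μ₀.prod μ₁) f) -
        crossMoment (withL1Density (μ₀.prod μ₁) g)) i j ^ 2
      ≤ ∑ _i : Fin d₀, ∑ _j : Fin d₁, (R * R * ‖f - g‖) ^ 2 :=
        Finset.sum_le_sum fun i _ ↦ Finset.sum_le_sum fun j _ ↦ hentry i j
    _ = d₀ * d₁ * (R * R) ^ 2 * ‖f - g‖ ^ 2 := by simp; ring
    _ ≤ _ := by gcongr; linarith

/-- The entropic transport problem has a solution, around which the objective grows at least
quadratically in the cross-correlation matrix, with a rate independent of the cost matrix. -/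
theorem exists_eotLoss_minimizer [IsProbabilityMeasure μ₀] [IsProbabilityMeasure μ₁] {R ε : ℝ}
    (hε : 0 < ε) (h₀ : ∀ᵐ x ∂μ₀, ‖x‖ ≤ R) (h₁ : ∀ᵐ y ∂μ₁, ‖y‖ ≤ R) :
    ∃ κ, 0 < κ ∧ ∀ A, ∃ π ∈ finCouplings μ₀ μ₁, ∀ π' ∈ finCouplings μ₀ μ₁,
      eotLoss ε μ₀ μ₁ A π + κ * ‖crossMoment π' - crossMoment π‖ ^ 2 ≤ eotLoss ε μ₀ μ₁ A π' ∧
      (eotLoss ε μ₀ μ₁ A π' ≤ eotLoss ε μ₀ μ₁ A π → π' = π) := by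
  obtain ⟨K, hK0, hK⟩ := exists_crossMoment_sub_le h₀ h₁
  -- The growth `ε / 8` comes from the entropy alone and `K` from the supports, so the rate is
  -- uniform in `A`.
  refine ⟨ε / 8 / K, by positivity, fun A ↦ ?_⟩
  obtain ⟨B, hB⟩ := exists_ae_bound_of_continuous h₀ h₁ (continuous_cost A)
  obtain ⟨g₀, hg₀, hgk₀, -⟩ := mem_finCouplings_iff.1 (prod_mem_finCouplings (μ₀ := μ₀) (μ₁ := μ₁))
  obtain ⟨f, hf, hfk, hmin⟩ := exists_entropicLoss_minimizer
    (continuous_cost A).aestronglyMeasurable (hB _ prod_mem_couplings) hε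
    isClosed_couplingDensities (fun f hf g hg ↦ midpoint_mem_couplingDensities hf hg)
    (fun f hf ↦ coeFn_nonneg_of_mem_couplingDensities hf)
    (fun f hf ↦ integral_of_mem_couplingDensities hf) ⟨g₀, hg₀, hgk₀⟩
  refine ⟨_, mem_finCouplings_iff.2 ⟨f, hf, hfk, rfl⟩, fun π' hπ' ↦ ?_⟩
  obtain ⟨g, hg, hgk, rfl⟩ := mem_finCouplings_iff.1 hπ'
  have h := hmin g hg hgk
  rw [eotLoss_withL1Density ε A hf, eotLoss_withL1Density ε A hg]
  constructor
  · have h2 := mul_le_mul_of_nonneg_left (hK g hg f hf) (by positivity : 0 ≤ ε / 8 / K)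
    have h3 : ε / 8 / K * (K * ‖g - f‖ ^ 2) = ε / 8 * ‖g - f‖ ^ 2 := by field_simp
    linarith
  · intro hle
    have h2 : ε / 8 * ‖g - f‖ ^ 2 ≤ 0 := by linarith
    have h3 : ‖g - f‖ ^ 2 ≤ 0 := by
      by_contra hcon
      have : 0 < ε / 8 * ‖g - f‖ ^ 2 := by have := not_le.1 hcon; positivity
      linarith
    have h4 : ‖g - f‖ = 0 := by
      have := norm_nonneg (g - f)
      nlinarith
    rw [sub_eq_zero.1 (norm_eq_zero.1 h4)]

end Couplings

/-! ### Frobenius inner product and a differentiability criterion. -/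

section FrobeniusInner

variable {d₀ d₁ : ℕ}

/-- The Frobenius inner product of two matrices. -/
noncomputable def frobInner (A B : Mat d₀ d₁) : ℝ := ∑ i, ∑ j, A i j * B i j

theorem frobInner_self (A : Mat d₀ d₁) : frobInner A A = ‖A‖ ^ 2 := by
  rw [frobenius_norm_sq]
  simp only [frobInner, sq]

theorem frobInner_add_left (A B C : Mat d₀ d₁) :
    frobInner (A + B) C = frobInner A C + frobInner B C := by
  simp only [frobInner, Matrix.add_apply, add_mul, Finset.sum_add_distrib]

theorem frobInner_comm (A B : Mat d₀ d₁) : frobInner A B = frobInner B A := by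
  simp only [frobInner, mul_comm]

theorem frobInner_smul_left (c : ℝ) (A B : Mat d₀ d₁) :
    frobInner (c • A) B = c * frobInner A B := by
  simp only [frobInner, Matrix.smul_apply, smul_eq_mul, mul_assoc, Finset.mul_sum]

theorem frobInner_sub_left (A B C : Mat d₀ d₁) :
    frobInner (A - B) C = frobInner A C - frobInner B C := by
  simp only [frobInner, Matrix.sub_apply, sub_mul, Finset.sum_sub_distrib]

theorem frobInner_sub_right (A B C : Mat d₀ d₁) :
    frobInner A (B - C) = frobInner A B - frobInner A C := by
  rw [frobInner_comm, frobInner_sub_left, frobInner_comm B, frobInner_comm C]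

theorem norm_add_sq_frobenius (A B : Mat d₀ d₁) :
    ‖A + B‖ ^ 2 = ‖A‖ ^ 2 + 2 * frobInner A B + ‖B‖ ^ 2 := by
  rw [← frobInner_self, ← frobInner_self, ← frobInner_self, frobInner_add_left,
    frobInner_comm _ (A + B), frobInner_comm _ (A + B), frobInner_add_left, frobInner_add_left,
    frobInner_comm B A]
  ring

theorem norm_sub_sq_frobenius (A B : Mat d₀ d₁) :
    ‖A - B‖ ^ 2 = ‖A‖ ^ 2 - 2 * frobInner A B + ‖B‖ ^ 2 := by
  have h := norm_add_sq_frobenius (A - B) B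
  rw [sub_add_cancel, frobInner_sub_left, frobInner_self] at h
  linarith

theorem abs_frobInner_le (A B : Mat d₀ d₁) : |frobInner A B| ≤ ‖A‖ * ‖B‖ := by
  refine abs_le_of_sq_le_sq ?_ (by positivity)
  rw [mul_pow, frobenius_norm_sq, frobenius_norm_sq, frobInner, ← Fintype.sum_prod_type',
    ← Fintype.sum_prod_type' (f := fun i j ↦ A i j ^ 2),
    ← Fintype.sum_prod_type' (f := fun i j ↦ B i j ^ 2)]
  exact Finset.sum_mul_sq_le_sq_mul_sq _ _ _

/-- The Frobenius inner product with a fixed matrix, as a continuous linear functional. -/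
noncomputable def frobInnerCLM (A : Mat d₀ d₁) : Mat d₀ d₁ →L[ℝ] ℝ :=
  LinearMap.mkContinuous
    { toFun := frobInner A
      map_add' := fun B C ↦ by
        rw [frobInner_comm, frobInner_add_left, frobInner_comm B, frobInner_comm C]
      map_smul' := fun c B ↦ by
        rw [frobInner_comm, frobInner_smul_left, frobInner_comm B]; rfl } ‖A‖
    fun B ↦ abs_frobInner_le A B

theorem frobInnerCLM_apply (A B : Mat d₀ d₁) : frobInnerCLM A B = frobInner A B := rfl

theorem frobInnerCLM_eq_zero_iff {A : Mat d₀ d₁} : frobInnerCLM A = 0 ↔ A = 0 := by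
  constructor
  · intro h
    have h1 : frobInner A A = 0 := by rw [← frobInnerCLM_apply, h]; rfl
    rw [frobInner_self] at h1
    exact norm_eq_zero.1 (pow_eq_zero_iff two_ne_zero |>.1 h1)
  · rintro rfl
    ext B
    simp [frobInnerCLM_apply, frobInner]

/-- A function with a first-order expansion of quadratic error is differentiable. -/
theorem hasFDerivAt_of_abs_sub_le_sq {f : Mat d₀ d₁ → ℝ} {A : Mat d₀ d₁}
    {f' : Mat d₀ d₁ →L[ℝ] ℝ} {K : ℝ} (h : ∀ H, |f (A + H) - f A - f' H| ≤ K * ‖H‖ ^ 2) :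
    HasFDerivAt f f' A := by
  refine hasFDerivAt_iff_isLittleO_nhds_zero.2 ?_
  refine Asymptotics.IsBigO.trans_isLittleO (g := fun H : Mat d₀ d₁ ↦ ‖H‖ ^ 2)
    (Asymptotics.IsBigO.of_bound K (Filter.Eventually.of_forall fun H ↦ ?_)) ?_
  · rw [Real.norm_eq_abs, Real.norm_of_nonneg (by positivity)]
    exact h H
  · exact Asymptotics.isLittleO_norm_pow_id one_lt_two

end FrobeniusInner

/-! ### The transport problem as a function of `A`: gradient of `Φ`, stationary points, coercivity.
-/

section Transport

variable {d₀ d₁ : ℕ} {μ₀ : Measure (E d₀)} {μ₁ : Measure (E d₁)}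

theorem cost_eq_sub_sum (A : Mat d₀ d₁) (p : E d₀ × E d₁) :
    cost A p = cost 0 p - 32 * ∑ i, ∑ j, A i j * (p.1 i * p.2 j) := by
  simp only [cost, Matrix.mulVec, dotProduct, Finset.mul_sum]
  simp only [Matrix.zero_apply, zero_mul, mul_zero, Finset.sum_const_zero, sub_zero]
  congr 1
  exact Finset.sum_congr rfl fun i _ ↦ Finset.sum_congr rfl fun j _ ↦ by ring

/-- The bilinear term `xᵀ A y` integrates to the pairing of `A` with the cross-moment, so `A` enters
only affinely. -/
theorem eotLoss_eq_sub_frobInner [IsProbabilityMeasure μ₀] {R : ℝ} (ε : ℝ)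
    (h₀ : ∀ᵐ x ∂μ₀, ‖x‖ ≤ R) (h₁ : ∀ᵐ y ∂μ₁, ‖y‖ ≤ R) (A : Mat d₀ d₁)
    {π : Measure (E d₀ × E d₁)} (hπ : π ∈ couplings μ₀ μ₁) :
    eotLoss ε μ₀ μ₁ A π = eotLoss ε μ₀ μ₁ 0 π - 32 * frobInner A (crossMoment π) := by
  have hI : ∀ {h : E d₀ × E d₁ → ℝ}, Continuous h → Integrable h π := fun hh ↦
    integrable_of_continuous_of_mem_couplings h₀ h₁ hh hπ
  have h : ∫ p, cost A p ∂π = ∫ p, cost 0 p ∂π - 32 * frobInner A (crossMoment π) := by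
    simp_rw [cost_eq_sub_sum A]
    rw [integral_sub (hI (continuous_cost 0)) (hI (by fun_prop)), integral_const_mul,
      integral_finsetSum _ fun i _ ↦ hI (by fun_prop)]
    congr 2
    refine Finset.sum_congr rfl fun i _ ↦ ?_
    rw [integral_finsetSum _ fun j _ ↦ hI (by fun_prop)]
    refine Finset.sum_congr rfl fun j _ ↦ ?_
    rw [integral_const_mul, crossMoment_apply]
  unfold eotLoss
  rw [h]; ring

theorem sq_integral_mul_le {α : Type*} [MeasurableSpace α] {π : Measure α} {u v : α → ℝ}
    (hu : Integrable (fun x ↦ u x ^ 2) π) (hv : Integrable (fun x ↦ v x ^ 2) π)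
    (huv : Integrable (fun x ↦ u x * v x) π) :
    (∫ x, u x * v x ∂π) ^ 2 ≤ (∫ x, u x ^ 2 ∂π) * ∫ x, v x ^ 2 ∂π := by
  -- Cauchy–Schwarz by the discriminant: the quadratic in `t` is `∫ (t u + v)²`.
  have h : ∀ t : ℝ, 0 ≤ (∫ x, u x ^ 2 ∂π) * (t * t) + (2 * ∫ x, u x * v x ∂π) * t +
      ∫ x, v x ^ 2 ∂π := by
    intro t
    have e : ∫ x, (t * u x + v x) ^ 2 ∂π = (∫ x, u x ^ 2 ∂π) * (t * t) +
        (2 * ∫ x, u x * v x ∂π) * t + ∫ x, v x ^ 2 ∂π := by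
      have : ∀ x, (t * u x + v x) ^ 2 = (t * t) * u x ^ 2 + (2 * t) * (u x * v x) + v x ^ 2 :=
        fun x ↦ by ring
      simp_rw [this]
      have h1 := hu.const_mul (t * t)
      have h2 := huv.const_mul (2 * t)
      have h12 : Integrable (fun x ↦ t * t * u x ^ 2 + 2 * t * (u x * v x)) π := h1.add h2
      rw [integral_add h12 hv, integral_add h1 h2, integral_const_mul,
        integral_const_mul]
      ring
    rw [← e]
    exact integral_nonneg fun x ↦ sq_nonneg _
  have := discrim_le_zero h
  unfold discrim at this
  nlinarith

theorem integral_fst_of_mem_couplings {π : Measure (E d₀ × E d₁)} (hπ : π ∈ couplings μ₀ μ₁)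
    {h : E d₀ → ℝ} (hh : Continuous h) : ∫ p, h p.1 ∂π = ∫ x, h x ∂μ₀ := by
  rw [← hπ.1, integral_map measurable_fst.aemeasurable hh.aestronglyMeasurable]

theorem integral_snd_of_mem_couplings {π : Measure (E d₀ × E d₁)} (hπ : π ∈ couplings μ₀ μ₁)
    {h : E d₁ → ℝ} (hh : Continuous h) : ∫ p, h p.2 ∂π = ∫ y, h y ∂μ₁ := by
  rw [← hπ.2, integral_map measurable_snd.aemeasurable hh.aestronglyMeasurable]

/-- Cauchy–Schwarz holds entry by entry, and the summed products factor into the two second moments.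
-/
theorem norm_crossMoment_le [IsProbabilityMeasure μ₀] {R : ℝ}
    (h₀ : ∀ᵐ x ∂μ₀, ‖x‖ ≤ R) (h₁ : ∀ᵐ y ∂μ₁, ‖y‖ ≤ R)
    {π : Measure (E d₀ × E d₁)} (hπ : π ∈ couplings μ₀ μ₁) :
    ‖crossMoment π‖ ≤ √(secondMoment μ₀ * secondMoment μ₁) := by
  have hI : ∀ {h : E d₀ × E d₁ → ℝ}, Continuous h → Integrable h π := fun hh ↦
    integrable_of_continuous_of_mem_couplings h₀ h₁ hh hπ
  refine Real.le_sqrt_of_sq_le ?_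
  rw [frobenius_norm_sq]
  have e0 : secondMoment μ₀ = ∑ i, ∫ p, p.1 i ^ 2 ∂π := by
    rw [← integral_finsetSum _ fun i _ ↦ hI (by fun_prop), secondMoment,
      ← integral_fst_of_mem_couplings hπ (by fun_prop)]
    simp only [EuclideanSpace.norm_sq_eq, Real.norm_eq_abs, sq_abs]
  have e1 : secondMoment μ₁ = ∑ j, ∫ p, p.2 j ^ 2 ∂π := by
    rw [← integral_finsetSum _ fun i _ ↦ hI (by fun_prop), secondMoment,
      ← integral_snd_of_mem_couplings hπ (by fun_prop)]
    simp only [EuclideanSpace.norm_sq_eq, Real.norm_eq_abs, sq_abs]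
  rw [e0, e1, Finset.sum_mul_sum]
  exact Finset.sum_le_sum fun i _ ↦ Finset.sum_le_sum fun j _ ↦
    sq_integral_mul_le (hI (by fun_prop)) (hI (by fun_prop)) (hI (by fun_prop))

theorem eotObjective_of_mem_finCouplings {ε : ℝ} (hε : 0 < ε) (A : Mat d₀ d₁)
    {π : Measure (E d₀ × E d₁)} (hπ : π ∈ finCouplings μ₀ μ₁) :
    eotObjective ε μ₀ μ₁ A π = (eotLoss ε μ₀ μ₁ A π : EReal) := by
  have h : ENNReal.ofReal ε * klDiv π (μ₀.prod μ₁) =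
      ENNReal.ofReal (ε * (klDiv π (μ₀.prod μ₁)).toReal) := by
    rw [ENNReal.ofReal_mul hε.le, ENNReal.ofReal_toReal hπ.2]
  rw [eotObjective, eotLoss, h, EReal.coe_ennreal_ofReal, max_eq_left (by positivity),
    EReal.coe_add]

theorem eotObjective_of_klDiv_eq_top {ε : ℝ} (hε : 0 < ε) (A : Mat d₀ d₁)
    {π : Measure (E d₀ × E d₁)} (hπ : klDiv π (μ₀.prod μ₁) = ∞) :
    eotObjective ε μ₀ μ₁ A π = ⊤ := by
  rw [eotObjective, hπ, ENNReal.mul_top (by simpa using hε), EReal.coe_ennreal_top,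
    EReal.coe_add_top]

/-- Couplings of infinite divergence have objective `⊤`, so the extended infimum is the real minimum
over the others. -/
theorem eotValue_of_isMin {ε : ℝ} (hε : 0 < ε) {A : Mat d₀ d₁}
    {π₀ : Measure (E d₀ × E d₁)} (hπ₀ : π₀ ∈ finCouplings μ₀ μ₁)
    (hmin : ∀ π ∈ finCouplings μ₀ μ₁, eotLoss ε μ₀ μ₁ A π₀ ≤ eotLoss ε μ₀ μ₁ A π) :
    eotValue ε μ₀ μ₁ A = (eotLoss ε μ₀ μ₁ A π₀ : EReal) := by
  refine le_antisymm ?_ ?_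
  · rw [← eotObjective_of_mem_finCouplings hε A hπ₀]
    exact iInf₂_le π₀ hπ₀.1
  · refine le_iInf₂ fun π hπ ↦ ?_
    by_cases hk : klDiv π (μ₀.prod μ₁) = ∞
    · rw [eotObjective_of_klDiv_eq_top hε A hk]
      exact le_top
    · rw [eotObjective_of_mem_finCouplings hε A ⟨hπ, hk⟩]
      exact EReal.coe_le_coe_iff.2 (hmin π ⟨hπ, hk⟩)

theorem eotCoupling_eq_of_isMin {ε : ℝ} (hε : 0 < ε) {A : Mat d₀ d₁}
    {π₀ : Measure (E d₀ × E d₁)} (hπ₀ : π₀ ∈ finCouplings μ₀ μ₁)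
    (hmin : ∀ π ∈ finCouplings μ₀ μ₁, eotLoss ε μ₀ μ₁ A π₀ ≤ eotLoss ε μ₀ μ₁ A π ∧
      (eotLoss ε μ₀ μ₁ A π ≤ eotLoss ε μ₀ μ₁ A π₀ → π = π₀)) :
    eotCoupling ε μ₀ μ₁ A = π₀ ∧ ∀ π, IsEOTOptimal ε μ₀ μ₁ A π ↔ π = π₀ := by
  have hval := eotValue_of_isMin hε hπ₀ fun π hπ ↦ (hmin π hπ).1
  have hopt : ∀ π, IsEOTOptimal ε μ₀ μ₁ A π ↔ π = π₀ := by
    intro π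
    constructor
    · rintro ⟨hπ, he⟩
      by_cases hk : klDiv π (μ₀.prod μ₁) = ∞
      · rw [eotObjective_of_klDiv_eq_top hε A hk, hval] at he
        exact absurd he.symm (EReal.coe_ne_top _)
      · rw [eotObjective_of_mem_finCouplings hε A ⟨hπ, hk⟩, hval] at he
        exact (hmin π ⟨hπ, hk⟩).2 (EReal.coe_eq_coe_iff.1 he).le
    · rintro rfl
      exact ⟨hπ₀.1, by rw [hval, eotObjective_of_mem_finCouplings hε A hπ₀]⟩
  -- Uniqueness identifies the `Classical.epsilon` choice with `π₀`.
  exact ⟨(hopt _).1 (Classical.epsilon_spec ⟨π₀, (hopt π₀).2 rfl⟩), hopt⟩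

/-- `κ` is a rate of quadratic growth of the entropic transport objectives around the
entropic transport couplings. -/
def HasGrowth (ε : ℝ) (μ₀ : Measure (E d₀)) (μ₁ : Measure (E d₁)) (κ : ℝ) : Prop :=
  0 < κ ∧ ∀ A, eotCoupling ε μ₀ μ₁ A ∈ finCouplings μ₀ μ₁ ∧
    ∀ π ∈ finCouplings μ₀ μ₁,
      eotLoss ε μ₀ μ₁ A (eotCoupling ε μ₀ μ₁ A) +
        κ * ‖crossMoment π - crossMoment (eotCoupling ε μ₀ μ₁ A)‖ ^ 2 ≤ eotLoss ε μ₀ μ₁ A π ∧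
      (eotLoss ε μ₀ μ₁ A π ≤ eotLoss ε μ₀ μ₁ A (eotCoupling ε μ₀ μ₁ A) →
        π = eotCoupling ε μ₀ μ₁ A)

theorem exists_hasGrowth [IsProbabilityMeasure μ₀] [IsProbabilityMeasure μ₁] {R ε : ℝ}
    (hε : 0 < ε) (h₀ : ∀ᵐ x ∂μ₀, ‖x‖ ≤ R) (h₁ : ∀ᵐ y ∂μ₁, ‖y‖ ≤ R) :
    ∃ κ, HasGrowth ε μ₀ μ₁ κ := by
  obtain ⟨κ, hκ, h⟩ := exists_eotLoss_minimizer hε h₀ h₁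
  refine ⟨κ, hκ, fun A ↦ ?_⟩
  obtain ⟨π₀, hπ₀, hmin⟩ := h A
  have he := (eotCoupling_eq_of_isMin hε hπ₀ fun π hπ ↦
    ⟨by have := (hmin π hπ).1; have : 0 ≤ κ * ‖crossMoment π - crossMoment π₀‖ ^ 2 := by positivity
        linarith, (hmin π hπ).2⟩).1
  rw [he]
  exact ⟨hπ₀, hmin⟩

namespace HasGrowth

variable {ε κ : ℝ}

theorem eotLoss_le (hg : HasGrowth ε μ₀ μ₁ κ) (A : Mat d₀ d₁) {π : Measure (E d₀ × E d₁)}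
    (hπ : π ∈ finCouplings μ₀ μ₁) :
    eotLoss ε μ₀ μ₁ A (eotCoupling ε μ₀ μ₁ A) ≤ eotLoss ε μ₀ μ₁ A π := by
  have h := ((hg.2 A).2 π hπ).1
  have : 0 ≤ κ * ‖crossMoment π - crossMoment (eotCoupling ε μ₀ μ₁ A)‖ ^ 2 :=
    mul_nonneg hg.1.le (sq_nonneg _)
  linarith

theorem eotValue_eq (hg : HasGrowth ε μ₀ μ₁ κ) (hε : 0 < ε) (A : Mat d₀ d₁) :
    eotValue ε μ₀ μ₁ A = (eotLoss ε μ₀ μ₁ A (eotCoupling ε μ₀ μ₁ A) : EReal) :=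
  eotValue_of_isMin hε (hg.2 A).1 fun _ hπ ↦ hg.eotLoss_le A hπ

theorem isEOTOptimal_iff (hg : HasGrowth ε μ₀ μ₁ κ) (hε : 0 < ε) (A : Mat d₀ d₁)
    (π : Measure (E d₀ × E d₁)) :
    IsEOTOptimal ε μ₀ μ₁ A π ↔ π = eotCoupling ε μ₀ μ₁ A :=
  (eotCoupling_eq_of_isMin hε (hg.2 A).1 fun π hπ ↦
    ⟨hg.eotLoss_le A hπ, ((hg.2 A).2 π hπ).2⟩).2 π

theorem Phi_eq (hg : HasGrowth ε μ₀ μ₁ κ) (hε : 0 < ε) (A : Mat d₀ d₁) :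
    Phi ε μ₀ μ₁ A = 32 * ‖A‖ ^ 2 + eotLoss ε μ₀ μ₁ A (eotCoupling ε μ₀ μ₁ A) := by
  rw [Phi, hg.eotValue_eq hε, EReal.toReal_coe]

theorem Phi_le (hg : HasGrowth ε μ₀ μ₁ κ) (hε : 0 < ε) (A : Mat d₀ d₁)
    {π : Measure (E d₀ × E d₁)} (hπ : π ∈ finCouplings μ₀ μ₁) :
    Phi ε μ₀ μ₁ A ≤ 32 * ‖A‖ ^ 2 + eotLoss ε μ₀ μ₁ A π := by
  rw [hg.Phi_eq hε]
  have := hg.eotLoss_le A hπ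
  linarith

variable [IsProbabilityMeasure μ₀] {R : ℝ}

/-- An envelope argument: testing the problem at `A + H` with `π_A` bounds the increment above;
testing the growth inequality at `A` with `π_{A+H}` bounds it below, the term `κ‖C' - C‖²` absorbing
the change of coupling. -/
theorem hasFDerivAt_Phi (hg : HasGrowth ε μ₀ μ₁ κ) (hε : 0 < ε) (h₀ : ∀ᵐ x ∂μ₀, ‖x‖ ≤ R)
    (h₁ : ∀ᵐ y ∂μ₁, ‖y‖ ≤ R) (A : Mat d₀ d₁) :
    HasFDerivAt (Phi ε μ₀ μ₁)
      (frobInnerCLM ((64 : ℝ) • A - (32 : ℝ) • crossMoment (eotCoupling ε μ₀ μ₁ A))) A := by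
  -- `32` is the second-order part of `32‖A‖²`; `256 / κ` comes from completing the square in `32
  -- ‖H‖ ‖C' - C‖`.
  refine hasFDerivAt_of_abs_sub_le_sq (K := 32 + 256 / κ) fun H ↦ ?_
  have hκ := hg.1
  have hA := (hg.2 A).1
  have hAH := (hg.2 (A + H)).1
  rw [frobInnerCLM_apply, frobInner_sub_left, frobInner_smul_left, frobInner_smul_left,
    hg.Phi_eq hε, hg.Phi_eq hε, norm_add_sq_frobenius]
  have hup := hg.eotLoss_le (A + H) hA
  have hlow := ((hg.2 A).2 _ hAH).1
  rw [eotLoss_eq_sub_frobInner ε h₀ h₁ (A + H) hA.1, frobInner_add_left] at hup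
  rw [eotLoss_eq_sub_frobInner ε h₀ h₁ A hAH.1] at hlow
  have e1 := eotLoss_eq_sub_frobInner ε h₀ h₁ A hA.1
  have e2 := eotLoss_eq_sub_frobInner ε h₀ h₁ (A + H) hAH.1
  rw [frobInner_add_left] at e2
  rw [frobInner_comm A H, frobInner_comm (crossMoment _) H]
  set C := crossMoment (eotCoupling ε μ₀ μ₁ A)
  set C' := crossMoment (eotCoupling ε μ₀ μ₁ (A + H))
  have hcs := le_of_abs_le (abs_frobInner_le H (C' - C))
  rw [frobInner_sub_right] at hcs
  have hsq : 32 * (‖H‖ * ‖C' - C‖) ≤ κ * ‖C' - C‖ ^ 2 + 256 / κ * ‖H‖ ^ 2 := by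
    have h : 0 ≤ (κ * ‖C' - C‖ - 16 * ‖H‖) ^ 2 / κ := by positivity
    have h' : (κ * ‖C' - C‖ - 16 * ‖H‖) ^ 2 / κ =
        κ * ‖C' - C‖ ^ 2 + 256 / κ * ‖H‖ ^ 2 - 32 * (‖H‖ * ‖C' - C‖) := by
      field_simp
      ring
    linarith
  have hpos : 0 ≤ 256 / κ * ‖H‖ ^ 2 := by positivity
  have hpos' : 0 ≤ 32 * ‖H‖ ^ 2 := by positivity
  rw [add_mul, abs_le]
  constructor <;> linarith

theorem isStationaryPoint_iff (hg : HasGrowth ε μ₀ μ₁ κ) (hε : 0 < ε) (h₀ : ∀ᵐ x ∂μ₀, ‖x‖ ≤ R)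
    (h₁ : ∀ᵐ y ∂μ₁, ‖y‖ ≤ R) (A : Mat d₀ d₁) :
    IsStationaryPoint (Phi ε μ₀ μ₁) A ↔
      A = (1 / 2 : ℝ) • crossMoment (eotCoupling ε μ₀ μ₁ A) := by
  have hd := hg.hasFDerivAt_Phi hε h₀ h₁ A
  have key : (64 : ℝ) • A - (32 : ℝ) • crossMoment (eotCoupling ε μ₀ μ₁ A) =
      (64 : ℝ) • (A - (1 / 2 : ℝ) • crossMoment (eotCoupling ε μ₀ μ₁ A)) := by
    module
  have hz : frobInnerCLM ((64 : ℝ) • A - (32 : ℝ) • crossMoment (eotCoupling ε μ₀ μ₁ A)) = 0 ↔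
      A = (1 / 2 : ℝ) • crossMoment (eotCoupling ε μ₀ μ₁ A) := by
    rw [frobInnerCLM_eq_zero_iff, key, smul_eq_zero_iff_right (by norm_num), sub_eq_zero]
  rw [← hz]
  constructor
  · intro h
    exact hd.unique h
  · intro h
    rw [h] at hd
    exact hd

theorem isStationaryPoint_of_isMinimizer (hg : HasGrowth ε μ₀ μ₁ κ) (hε : 0 < ε)
    (h₀ : ∀ᵐ x ∂μ₀, ‖x‖ ≤ R) (h₁ : ∀ᵐ y ∂μ₁, ‖y‖ ≤ R) {A : Mat d₀ d₁}
    (hA : IsMinimizer (Phi ε μ₀ μ₁) A) : IsStationaryPoint (Phi ε μ₀ μ₁) A := by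
  have hd := hg.hasFDerivAt_Phi hε h₀ h₁ A
  have hmin : IsLocalMin (Phi ε μ₀ μ₁) A := Filter.Eventually.of_forall hA
  rw [hmin.hasFDerivAt_eq_zero hd] at hd
  exact hd

theorem mem_ballD_of_isStationaryPoint (hg : HasGrowth ε μ₀ μ₁ κ) (hε : 0 < ε)
    (h₀ : ∀ᵐ x ∂μ₀, ‖x‖ ≤ R) (h₁ : ∀ᵐ y ∂μ₁, ‖y‖ ≤ R) {A : Mat d₀ d₁}
    (hA : IsStationaryPoint (Phi ε μ₀ μ₁) A) :
    A ∈ ballD d₀ d₁ √(secondMoment μ₀ * secondMoment μ₁) := by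
  have hC := norm_crossMoment_le h₀ h₁ (hg.2 A).1.1
  have h := congrArg norm ((hg.isStationaryPoint_iff hε h₀ h₁ A).1 hA)
  rw [norm_smul, Real.norm_of_nonneg (by norm_num)] at h
  change ‖A‖ ≤ _
  linarith

theorem tendsto_Phi_cobounded (hg : HasGrowth ε μ₀ μ₁ κ) (hε : 0 < ε)
    (h₀ : ∀ᵐ x ∂μ₀, ‖x‖ ≤ R) (h₁ : ∀ᵐ y ∂μ₁, ‖y‖ ≤ R) :
    Filter.Tendsto (Phi ε μ₀ μ₁) (Bornology.cobounded (Mat d₀ d₁)) Filter.atTop := by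
  set N := √(secondMoment μ₀ * secondMoment μ₁)
  set L := eotLoss ε μ₀ μ₁ 0 (eotCoupling ε μ₀ μ₁ (0 : Mat d₀ d₁))
  -- Cross-moments are bounded by `N`, so the transport value drops at most linearly below its value
  -- `L` at `A = 0`.
  have hle : ∀ A : Mat d₀ d₁, ‖A‖ * (32 * ‖A‖ - 32 * N) + L ≤ Phi ε μ₀ μ₁ A := by
    intro A
    have hA := (hg.2 A).1
    have h1 := hg.eotLoss_le 0 hA
    have h2 := le_of_abs_le (abs_frobInner_le A (crossMoment (eotCoupling ε μ₀ μ₁ A)))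
    have h3 := mul_le_mul_of_nonneg_left (norm_crossMoment_le h₀ h₁ hA.1) (norm_nonneg A)
    rw [hg.Phi_eq hε, eotLoss_eq_sub_frobInner ε h₀ h₁ A hA.1]
    nlinarith
  refine Filter.tendsto_atTop_mono hle ?_
  have hn : Filter.Tendsto (fun A : Mat d₀ d₁ ↦ ‖A‖) (Bornology.cobounded (Mat d₀ d₁))
      Filter.atTop := tendsto_norm_cobounded_atTop
  refine Filter.tendsto_atTop_add_const_right _ L (hn.atTop_mul_atTop₀ ?_)
  simp only [sub_eq_add_neg]
  exact Filter.tendsto_atTop_add_const_right _ _ (hn.const_mul_atTop (by norm_num))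

end HasGrowth

end Transport

/-! ### Joint bookkeeping of integrability and values of integrals. -/

section HasIntegralValue

variable {α : Type*} [MeasurableSpace α] {ν : Measure α} {f g : α → ℝ} {a b : ℝ}

/-- `f` is integrable with integral `a`. -/
def HasIntegralValue (ν : Measure α) (f : α → ℝ) (a : ℝ) : Prop :=
  Integrable f ν ∧ ∫ x, f x ∂ν = a

namespace HasIntegralValue

theorem add (hf : HasIntegralValue ν f a) (hg : HasIntegralValue ν g b) :
    HasIntegralValue ν (fun x ↦ f x + g x) (a + b) :=
  ⟨hf.1.add hg.1, by rw [integral_add hf.1 hg.1, hf.2, hg.2]⟩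

theorem sub (hf : HasIntegralValue ν f a) (hg : HasIntegralValue ν g b) :
    HasIntegralValue ν (fun x ↦ f x - g x) (a - b) :=
  ⟨hf.1.sub hg.1, by rw [integral_sub hf.1 hg.1, hf.2, hg.2]⟩

theorem const_mul (c : ℝ) (hf : HasIntegralValue ν f a) :
    HasIntegralValue ν (fun x ↦ c * f x) (c * a) :=
  ⟨hf.1.const_mul c, by rw [integral_const_mul, hf.2]⟩

theorem sum {ι : Type*} {s : Finset ι} {f : ι → α → ℝ} {a : ι → ℝ}
    (h : ∀ i, HasIntegralValue ν (f i) (a i)) :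
    HasIntegralValue ν (fun x ↦ ∑ i ∈ s, f i x) (∑ i ∈ s, a i) :=
  ⟨integrable_finsetSum _ fun i _ ↦ (h i).1, by
    rw [integral_finsetSum _ fun i _ ↦ (h i).1]
    exact Finset.sum_congr rfl fun i _ ↦ (h i).2⟩

theorem prod_mul {β : Type*} [MeasurableSpace β] {ν' : Measure β} [SFinite ν] [SFinite ν']
    {g : β → ℝ} (hf : HasIntegralValue ν f a) (hg : HasIntegralValue ν' g b) :
    HasIntegralValue (ν.prod ν') (fun q ↦ f q.1 * g q.2) (a * b) :=
  ⟨hf.1.mul_prod hg.1, by rw [integral_prod_mul, hf.2, hg.2]⟩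

end HasIntegralValue

end HasIntegralValue

/-! ### Decomposition of the EGW objective and its duality with `Φ`. -/

section GromovWasserstein

variable {d₀ d₁ : ℕ} {μ₀ : Measure (E d₀)} {μ₁ : Measure (E d₁)}

theorem integral_apply_eq_zero_of_centered {d : ℕ} {μ : Measure (E d)} [IsFiniteMeasure μ] {R : ℝ}
    (h : ∀ᵐ x ∂μ, ‖x‖ ≤ R) (hμ : Centered μ) (i : Fin d) : ∫ x, x i ∂μ = 0 := by
  have hi : Integrable (fun x : E d ↦ x) μ :=
    Integrable.of_bound continuous_id.aestronglyMeasurable R h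
  have := (EuclideanSpace.proj (𝕜 := ℝ) i).integral_comp_comm hi
  rw [show ∫ x, x ∂μ = 0 from hμ, map_zero] at this
  exact this

theorem norm_sub_sq_eq_sum {d : ℕ} (x y : E d) :
    ‖x - y‖ ^ 2 = ‖x‖ ^ 2 + ‖y‖ ^ 2 - 2 * ∑ i, x i * y i := by
  have : inner ℝ x y = ∑ i, x i * y i := by
    rw [PiLp.inner_apply]
    exact Finset.sum_congr rfl fun i _ ↦ by simp [mul_comm]
  rw [norm_sub_sq_real, this]; ring

/-- Every term is a function of `q.1` times a function of `q.2`, so that integrals against `π ⊗ π`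
factor; the factors `1` are there for this shape. -/
theorem norm_sub_sq_mul_norm_sub_sq (q : (E d₀ × E d₁) × (E d₀ × E d₁)) :
    ‖q.1.1 - q.2.1‖ ^ 2 * ‖q.1.2 - q.2.2‖ ^ 2 =
      (‖q.1.1‖ ^ 2 * ‖q.1.2‖ ^ 2) * 1 + 1 * (‖q.2.1‖ ^ 2 * ‖q.2.2‖ ^ 2) +
        (‖q.1.1‖ ^ 2 * ‖q.2.2‖ ^ 2 + ‖q.1.2‖ ^ 2 * ‖q.2.1‖ ^ 2) -
      2 * ((∑ j, (‖q.1.1‖ ^ 2 * q.1.2 j) * q.2.2 j + ∑ j, q.1.2 j * (‖q.2.1‖ ^ 2 * q.2.2 j)) +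
        (∑ i, (‖q.1.2‖ ^ 2 * q.1.1 i) * q.2.1 i + ∑ i, q.1.1 i * (‖q.2.2‖ ^ 2 * q.2.1 i))) +
      4 * ∑ i, ∑ j, (q.1.1 i * q.1.2 j) * (q.2.1 i * q.2.2 j) := by
  rw [norm_sub_sq_eq_sum, norm_sub_sq_eq_sum]
  have h1 : ∑ j, (‖q.1.1‖ ^ 2 * q.1.2 j) * q.2.2 j = ‖q.1.1‖ ^ 2 * ∑ j, q.1.2 j * q.2.2 j := by
    simp only [Finset.mul_sum, mul_assoc]
  have h2 : ∑ j, q.1.2 j * (‖q.2.1‖ ^ 2 * q.2.2 j) = ‖q.2.1‖ ^ 2 * ∑ j, q.1.2 j * q.2.2 j := by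
    simp only [Finset.mul_sum, mul_left_comm]
  have h3 : ∑ i, (‖q.1.2‖ ^ 2 * q.1.1 i) * q.2.1 i = ‖q.1.2‖ ^ 2 * ∑ i, q.1.1 i * q.2.1 i := by
    simp only [Finset.mul_sum, mul_assoc]
  have h4 : ∑ i, q.1.1 i * (‖q.2.2‖ ^ 2 * q.2.1 i) = ‖q.2.2‖ ^ 2 * ∑ i, q.1.1 i * q.2.1 i := by
    simp only [Finset.mul_sum, mul_left_comm]
  have h5 : ∑ i, ∑ j, (q.1.1 i * q.1.2 j) * (q.2.1 i * q.2.2 j) =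
      (∑ i, q.1.1 i * q.2.1 i) * ∑ j, q.1.2 j * q.2.2 j := by
    rw [Finset.sum_mul_sum]
    exact Finset.sum_congr rfl fun i _ ↦ Finset.sum_congr rfl fun j _ ↦ by ring
  rw [h1, h2, h3, h4, h5]
  ring

/-- The cross term of the quadratic Gromov-Wasserstein cost of centered measures. -/
theorem hasIntegralValue_norm_sub_sq_mul [IsProbabilityMeasure μ₀] [IsProbabilityMeasure μ₁] {R : ℝ}
    (h₀ : ∀ᵐ x ∂μ₀, ‖x‖ ≤ R) (h₁ : ∀ᵐ y ∂μ₁, ‖y‖ ≤ R) (hc₀ : Centered μ₀) (hc₁ : Centered μ₁)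
    {π : Measure (E d₀ × E d₁)} (hπ : π ∈ couplings μ₀ μ₁) :
    HasIntegralValue (π.prod π) (fun q ↦ ‖q.1.1 - q.2.1‖ ^ 2 * ‖q.1.2 - q.2.2‖ ^ 2)
      (2 * ∫ p, ‖p.1‖ ^ 2 * ‖p.2‖ ^ 2 ∂π + 2 * (secondMoment μ₀ * secondMoment μ₁) +
        4 * ‖crossMoment π‖ ^ 2) := by
  have := isProbabilityMeasure_of_mem_couplings hπ
  have hv : ∀ {h : E d₀ × E d₁ → ℝ}, Continuous h → HasIntegralValue π h (∫ p, h p ∂π) := fun hh ↦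
    ⟨integrable_of_continuous_of_mem_couplings h₀ h₁ hh hπ, rfl⟩
  have hone : HasIntegralValue π (fun _ ↦ (1 : ℝ)) 1 := ⟨integrable_const _, by simp⟩
  have hX : HasIntegralValue π (fun p ↦ ‖p.1‖ ^ 2) (secondMoment μ₀) :=
    ⟨(hv (by fun_prop)).1, integral_fst_of_mem_couplings hπ (h := fun x ↦ ‖x‖ ^ 2) (by fun_prop)⟩
  have hY : HasIntegralValue π (fun p ↦ ‖p.2‖ ^ 2) (secondMoment μ₁) :=
    ⟨(hv (by fun_prop)).1, integral_snd_of_mem_couplings hπ (h := fun x ↦ ‖x‖ ^ 2) (by fun_prop)⟩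
  have hx : ∀ i, HasIntegralValue π (fun p ↦ p.1 i) 0 := fun i ↦
    ⟨(hv (by fun_prop)).1, by
      rw [integral_fst_of_mem_couplings hπ (h := fun x ↦ x i) (by fun_prop),
        integral_apply_eq_zero_of_centered h₀ hc₀]⟩
  have hy : ∀ j, HasIntegralValue π (fun p ↦ p.2 j) 0 := fun j ↦
    ⟨(hv (by fun_prop)).1, by
      rw [integral_snd_of_mem_couplings hπ (h := fun x ↦ x j) (by fun_prop),
        integral_apply_eq_zero_of_centered h₁ hc₁]⟩
  have hXY := hv (h := fun p ↦ ‖p.1‖ ^ 2 * ‖p.2‖ ^ 2) (by fun_prop)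
  have hXy := fun j ↦ hv (h := fun p ↦ ‖p.1‖ ^ 2 * p.2 j) (by fun_prop)
  have hYx := fun i ↦ hv (h := fun p ↦ ‖p.2‖ ^ 2 * p.1 i) (by fun_prop)
  have hxy := fun i j ↦ hv (h := fun p ↦ p.1 i * p.2 j) (by fun_prop)
  -- The terms under the factor `2` each carry a mean of `x` or `y` and vanish by centering; the
  -- last double sum becomes `‖crossMoment π‖²`.
  have key := ((((hXY.prod_mul hone).add (hone.prod_mul hXY)).add
    ((hX.prod_mul hY).add (hY.prod_mul hX))).sub
    (HasIntegralValue.const_mul 2 (((HasIntegralValue.sum (s := Finset.univ)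
        fun j ↦ (hXy j).prod_mul (hy j)).add
      (HasIntegralValue.sum (s := Finset.univ) fun j ↦ (hy j).prod_mul (hXy j))).add
      ((HasIntegralValue.sum (s := Finset.univ) fun i ↦ (hYx i).prod_mul (hx i)).add
      (HasIntegralValue.sum (s := Finset.univ) fun i ↦ (hx i).prod_mul (hYx i)))))).add
    (HasIntegralValue.const_mul 4 (HasIntegralValue.sum (s := Finset.univ) fun i ↦
      HasIntegralValue.sum (s := Finset.univ) fun j ↦ (hxy i j).prod_mul (hxy i j)))
  simp only [norm_sub_sq_mul_norm_sub_sq]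
  convert key using 1
  rw [frobenius_norm_sq]
  simp only [crossMoment_apply, mul_zero, zero_mul, Finset.sum_const_zero, sq]
  ring

/-- The part of the quadratic Gromov-Wasserstein cost that depends only on the marginals. -/
noncomputable def marginalCost (μ₀ : Measure (E d₀)) (μ₁ : Measure (E d₁)) : ℝ :=
  ∫ z, ‖z.1 - z.2‖ ^ 4 ∂(μ₀.prod μ₀) + ∫ z, ‖z.1 - z.2‖ ^ 4 ∂(μ₁.prod μ₁) -
    4 * (secondMoment μ₀ * secondMoment μ₁)

/-- Push forward by `u × u`: the fourth-power terms see only the marginal. -/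
theorem hasIntegralValue_norm_sub_pow_four {d : ℕ} {α : Type*} [MeasurableSpace α]
    {π : Measure α} [IsProbabilityMeasure π] {μ : Measure (E d)} {R : ℝ}
    (h : ∀ᵐ x ∂μ, ‖x‖ ≤ R) {u : α → E d} (hu : Measurable u) (hπ : π.map u = μ) :
    HasIntegralValue (π.prod π) (fun q ↦ ‖u q.1 - u q.2‖ ^ 4)
      (∫ z, ‖z.1 - z.2‖ ^ 4 ∂(μ.prod μ)) := by
  have : IsProbabilityMeasure μ := hπ ▸ Measure.isProbabilityMeasure_map hu.aemeasurable
  have hmap : μ.prod μ = (π.prod π).map (Prod.map u u) := by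
    rw [← hπ, Measure.map_prod_map _ _ hu hu]
  have hcont : Continuous fun z : E d × E d ↦ ‖z.1 - z.2‖ ^ 4 := by fun_prop
  have hint : Integrable (fun z : E d × E d ↦ ‖z.1 - z.2‖ ^ 4) (μ.prod μ) :=
    integrable_of_continuous_of_mem_couplings h h hcont prod_mem_couplings
  refine ⟨?_, ?_⟩
  · rw [hmap] at hint
    exact hint.comp_measurable (hu.prodMap hu)
  · rw [hmap, integral_map (hu.prodMap hu).aemeasurable hcont.aestronglyMeasurable]
    rfl

/-- Expanding the square leaves marginal terms and `-2` times the cross term, whose coefficients `2`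
and `4` become the `-4` of `cost 0` and the `-8`. -/
theorem hasIntegralValue_gromovWasserstein [IsProbabilityMeasure μ₀] [IsProbabilityMeasure μ₁]
    {R : ℝ} (h₀ : ∀ᵐ x ∂μ₀, ‖x‖ ≤ R) (h₁ : ∀ᵐ y ∂μ₁, ‖y‖ ≤ R) (hc₀ : Centered μ₀)
    (hc₁ : Centered μ₁) {π : Measure (E d₀ × E d₁)} (hπ : π ∈ couplings μ₀ μ₁) :
    HasIntegralValue (π.prod π) (fun q ↦ |‖q.1.1 - q.2.1‖ ^ 2 - ‖q.1.2 - q.2.2‖ ^ 2| ^ 2)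
      (marginalCost μ₀ μ₁ + (∫ p, cost 0 p ∂π - 8 * ‖crossMoment π‖ ^ 2)) := by
  have := isProbabilityMeasure_of_mem_couplings hπ
  have key := ((hasIntegralValue_norm_sub_pow_four h₀ measurable_fst hπ.1).add
    (hasIntegralValue_norm_sub_pow_four h₁ measurable_snd hπ.2)).sub
    (HasIntegralValue.const_mul 2 (hasIntegralValue_norm_sub_sq_mul h₀ h₁ hc₀ hc₁ hπ))
  convert key using 1
  · funext q
    rw [sq_abs]; ring
  · have : ∫ p, cost 0 p ∂π = -4 * ∫ p, ‖p.1‖ ^ 2 * ‖p.2‖ ^ 2 ∂π := by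
      rw [← integral_const_mul]
      refine integral_congr_ae (Filter.Eventually.of_forall fun p ↦ ?_)
      simp only [cost, Matrix.zero_mulVec, dotProduct_zero]
      ring
    rw [this, marginalCost]
    ring

/-- The Gromov-Wasserstein objective of a coupling, minimized over the linearization matrix and
up to a constant that depends only on the marginals. -/
noncomputable def egwLoss (ε : ℝ) (μ₀ : Measure (E d₀)) (μ₁ : Measure (E d₁))
    (π : Measure (E d₀ × E d₁)) : ℝ :=
  eotLoss ε μ₀ μ₁ 0 π - 8 * ‖crossMoment π‖ ^ 2

/-- Completing the square in `32‖A‖² - 32⟨A, C⟩`. The remainder vanishes exactly at `A = C / 2`,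
which links the two problems. -/
theorem add_eotLoss_eq_egwLoss_add [IsProbabilityMeasure μ₀] {R : ℝ} (ε : ℝ)
    (h₀ : ∀ᵐ x ∂μ₀, ‖x‖ ≤ R) (h₁ : ∀ᵐ y ∂μ₁, ‖y‖ ≤ R) (A : Mat d₀ d₁)
    {π : Measure (E d₀ × E d₁)} (hπ : π ∈ couplings μ₀ μ₁) :
    32 * ‖A‖ ^ 2 + eotLoss ε μ₀ μ₁ A π =
      egwLoss ε μ₀ μ₁ π + 32 * ‖A - (1 / 2 : ℝ) • crossMoment π‖ ^ 2 := by
  rw [eotLoss_eq_sub_frobInner ε h₀ h₁ A hπ, norm_sub_sq_frobenius, frobInner_comm,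
    frobInner_comm A, frobInner_smul_left, norm_smul, mul_pow, egwLoss, Real.norm_eq_abs, sq_abs]
  ring

/-- Nonnegativity is recorded because `ENNReal.ofReal` reflects order only when the larger side is
nonnegative. -/
theorem egwObjective_of_mem_finCouplings [IsProbabilityMeasure μ₀] [IsProbabilityMeasure μ₁]
    {R ε : ℝ} (hε : 0 < ε) (h₀ : ∀ᵐ x ∂μ₀, ‖x‖ ≤ R) (h₁ : ∀ᵐ y ∂μ₁, ‖y‖ ≤ R)
    (hc₀ : Centered μ₀) (hc₁ : Centered μ₁) {π : Measure (E d₀ × E d₁)}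
    (hπ : π ∈ finCouplings μ₀ μ₁) :
    0 ≤ marginalCost μ₀ μ₁ + egwLoss ε μ₀ μ₁ π ∧
      egwObjective ε μ₀ μ₁ π = ENNReal.ofReal (marginalCost μ₀ μ₁ + egwLoss ε μ₀ μ₁ π) := by
  have hgw := hasIntegralValue_gromovWasserstein h₀ h₁ hc₀ hc₁ hπ.1
  have hk : ENNReal.ofReal ε * klDiv π (μ₀.prod μ₁) =
      ENNReal.ofReal (ε * (klDiv π (μ₀.prod μ₁)).toReal) := by
    rw [ENNReal.ofReal_mul hε.le, ENNReal.ofReal_toReal hπ.2]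
  have hk0 : 0 ≤ ε * (klDiv π (μ₀.prod μ₁)).toReal := by positivity
  have hg0 : 0 ≤ ∫ q, |‖q.1.1 - q.2.1‖ ^ 2 - ‖q.1.2 - q.2.2‖ ^ 2| ^ 2 ∂(π.prod π) :=
    integral_nonneg fun q ↦ by positivity
  have he : marginalCost μ₀ μ₁ + egwLoss ε μ₀ μ₁ π =
      ∫ q, |‖q.1.1 - q.2.1‖ ^ 2 - ‖q.1.2 - q.2.2‖ ^ 2| ^ 2 ∂(π.prod π) +
        ε * (klDiv π (μ₀.prod μ₁)).toReal := by
    rw [hgw.2, egwLoss, eotLoss]; ring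
  rw [he]
  refine ⟨add_nonneg hg0 hk0, ?_⟩
  rw [egwObjective, hk, ENNReal.ofReal_add hg0 hk0,
    ofReal_integral_eq_lintegral_ofReal hgw.1
      (Filter.Eventually.of_forall fun q ↦ by positivity)]

theorem isEGWOptimal_iff [IsProbabilityMeasure μ₀] [IsProbabilityMeasure μ₁]
    {R ε : ℝ} (hε : 0 < ε) (h₀ : ∀ᵐ x ∂μ₀, ‖x‖ ≤ R) (h₁ : ∀ᵐ y ∂μ₁, ‖y‖ ≤ R)
    (hc₀ : Centered μ₀) (hc₁ : Centered μ₁) (π : Measure (E d₀ × E d₁)) :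
    IsEGWOptimal ε μ₀ μ₁ π ↔ π ∈ finCouplings μ₀ μ₁ ∧
      ∀ π' ∈ finCouplings μ₀ μ₁, egwLoss ε μ₀ μ₁ π ≤ egwLoss ε μ₀ μ₁ π' := by
  have hobj := fun π (hπ : π ∈ finCouplings μ₀ μ₁) ↦
    egwObjective_of_mem_finCouplings hε h₀ h₁ hc₀ hc₁ hπ
  have htop : ∀ π, klDiv π (μ₀.prod μ₁) = ∞ → egwObjective ε μ₀ μ₁ π = ∞ := fun π hπ ↦ by
    rw [egwObjective, hπ, ENNReal.mul_top (by simpa using hε), add_top]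
  constructor
  · rintro ⟨hπ, he⟩
    have hle : ∀ π' ∈ finCouplings μ₀ μ₁, egwObjective ε μ₀ μ₁ π ≤ egwObjective ε μ₀ μ₁ π' :=
      fun π' hπ' ↦ he.trans_le (iInf₂_le π' hπ'.1)
    have hk : klDiv π (μ₀.prod μ₁) ≠ ∞ := by
      intro hk
      -- The product coupling has finite objective, so no optimal coupling has infinite divergence.
      have h := hle _ prod_mem_finCouplings
      rw [htop π hk, (hobj _ prod_mem_finCouplings).2, top_le_iff] at h
      exact ENNReal.ofReal_ne_top h
    refine ⟨⟨hπ, hk⟩, fun π' hπ' ↦ ?_⟩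
    have h := hle π' hπ'
    rw [(hobj π ⟨hπ, hk⟩).2, (hobj π' hπ').2, ENNReal.ofReal_le_ofReal_iff (hobj π' hπ').1] at h
    linarith
  · rintro ⟨hπ, hmin⟩
    refine ⟨hπ.1, le_antisymm (le_iInf₂ fun π' hπ' ↦ ?_) (iInf₂_le π hπ.1)⟩
    by_cases hk : klDiv π' (μ₀.prod μ₁) = ∞
    · rw [htop π' hk]; exact le_top
    · rw [(hobj π hπ).2, (hobj π' ⟨hπ', hk⟩).2]
      exact ENNReal.ofReal_le_ofReal (by have := hmin π' ⟨hπ', hk⟩; linarith)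

namespace HasGrowth

variable [IsProbabilityMeasure μ₀] {ε κ R : ℝ}

/-- Drop the square in the identity. With the next bound, this sandwiches the two minimum problems.
-/
theorem egwLoss_le_Phi (hg : HasGrowth ε μ₀ μ₁ κ) (hε : 0 < ε) (h₀ : ∀ᵐ x ∂μ₀, ‖x‖ ≤ R)
    (h₁ : ∀ᵐ y ∂μ₁, ‖y‖ ≤ R) (A : Mat d₀ d₁) :
    egwLoss ε μ₀ μ₁ (eotCoupling ε μ₀ μ₁ A) ≤ Phi ε μ₀ μ₁ A := by
  rw [hg.Phi_eq hε, add_eotLoss_eq_egwLoss_add ε h₀ h₁ A (hg.2 A).1.1]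
  have : 0 ≤ 32 * ‖A - (1 / 2 : ℝ) • crossMoment (eotCoupling ε μ₀ μ₁ A)‖ ^ 2 := by positivity
  linarith

/-- At this matrix the square vanishes, and `π` competes in the transport problem. -/
theorem Phi_half_crossMoment_le (hg : HasGrowth ε μ₀ μ₁ κ) (hε : 0 < ε) (h₀ : ∀ᵐ x ∂μ₀, ‖x‖ ≤ R)
    (h₁ : ∀ᵐ y ∂μ₁, ‖y‖ ≤ R) {π : Measure (E d₀ × E d₁)} (hπ : π ∈ finCouplings μ₀ μ₁) :
    Phi ε μ₀ μ₁ ((1 / 2 : ℝ) • crossMoment π) ≤ egwLoss ε μ₀ μ₁ π := by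
  have h := hg.Phi_le hε ((1 / 2 : ℝ) • crossMoment π) hπ
  rw [add_eotLoss_eq_egwLoss_add ε h₀ h₁ _ hπ.1, sub_self, norm_zero] at h
  linarith

theorem isMinimizer_half_crossMoment (hg : HasGrowth ε μ₀ μ₁ κ) (hε : 0 < ε)
    (h₀ : ∀ᵐ x ∂μ₀, ‖x‖ ≤ R) (h₁ : ∀ᵐ y ∂μ₁, ‖y‖ ≤ R) {π : Measure (E d₀ × E d₁)}
    (hπ : π ∈ finCouplings μ₀ μ₁)
    (hmin : ∀ π' ∈ finCouplings μ₀ μ₁, egwLoss ε μ₀ μ₁ π ≤ egwLoss ε μ₀ μ₁ π') :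
    IsMinimizer (Phi ε μ₀ μ₁) ((1 / 2 : ℝ) • crossMoment π) := fun B ↦
  ((hg.Phi_half_crossMoment_le hε h₀ h₁ hπ).trans (hmin _ (hg.2 B).1)).trans
    (hg.egwLoss_le_Phi hε h₀ h₁ B)

theorem eotCoupling_half_crossMoment (hg : HasGrowth ε μ₀ μ₁ κ) (hε : 0 < ε)
    (h₀ : ∀ᵐ x ∂μ₀, ‖x‖ ≤ R) (h₁ : ∀ᵐ y ∂μ₁, ‖y‖ ≤ R) {π : Measure (E d₀ × E d₁)}
    (hπ : π ∈ finCouplings μ₀ μ₁)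
    (hmin : ∀ π' ∈ finCouplings μ₀ μ₁, egwLoss ε μ₀ μ₁ π ≤ egwLoss ε μ₀ μ₁ π') :
    π = eotCoupling ε μ₀ μ₁ ((1 / 2 : ℝ) • crossMoment π) := by
  set A := (1 / 2 : ℝ) • crossMoment π with hA
  have h := add_eotLoss_eq_egwLoss_add ε h₀ h₁ A hπ.1
  rw [← hA, sub_self, norm_zero] at h
  have h2 := hmin _ (hg.2 A).1
  have h3 := hg.egwLoss_le_Phi hε h₀ h₁ A
  rw [hg.Phi_eq hε] at h3
  -- `π` does at least as well as `π_A` in the transport problem at `A`, and the solution is unique.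
  exact ((hg.2 A).2 π hπ).2 (by linarith)

theorem isMinimizer_iff (hg : HasGrowth ε μ₀ μ₁ κ) (hε : 0 < ε) (h₀ : ∀ᵐ x ∂μ₀, ‖x‖ ≤ R)
    (h₁ : ∀ᵐ y ∂μ₁, ‖y‖ ≤ R) (A : Mat d₀ d₁) :
    IsMinimizer (Phi ε μ₀ μ₁) A ↔
      (eotCoupling ε μ₀ μ₁ A ∈ finCouplings μ₀ μ₁ ∧ ∀ π' ∈ finCouplings μ₀ μ₁,
        egwLoss ε μ₀ μ₁ (eotCoupling ε μ₀ μ₁ A) ≤ egwLoss ε μ₀ μ₁ π') ∧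
      (1 / 2 : ℝ) • crossMoment (eotCoupling ε μ₀ μ₁ A) = A := by
  constructor
  · intro hA
    refine ⟨⟨(hg.2 A).1, fun π' hπ' ↦ ?_⟩, ?_⟩
    · exact ((hg.egwLoss_le_Phi hε h₀ h₁ A).trans (hA _)).trans
        (hg.Phi_half_crossMoment_le hε h₀ h₁ hπ')
    · exact ((hg.isStationaryPoint_iff hε h₀ h₁ A).1
        (hg.isStationaryPoint_of_isMinimizer hε h₀ h₁ hA)).symm
  · rintro ⟨⟨hπ, hmin⟩, he⟩
    have h := hg.isMinimizer_half_crossMoment hε h₀ h₁ hπ hmin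
    rwa [he] at h

end HasGrowth

end GromovWasserstein

/-! ### Bounded supports and assembly of the theorem. -/

theorem exists_ae_norm_le_of_isCompact_support {d : ℕ} {μ : Measure (E d)}
    (h : IsCompact μ.support) : ∃ R, ∀ᵐ x ∂μ, ‖x‖ ≤ R := by
  obtain ⟨R, hR⟩ := h.isBounded.exists_norm_le
  exact ⟨R, Filter.mem_of_superset Measure.support_mem_ae hR⟩

end EGW

theorem corollary1 (d₀ d₁ : ℕ) (ε : ℝ) (hε : 0 < ε)
    (μ₀ : Measure (EGW.E d₀)) (μ₁ : Measure (EGW.E d₁))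
    [IsProbabilityMeasure μ₀] [IsProbabilityMeasure μ₁]
    (hμ₀ : IsCompact μ₀.support) (hμ₁ : IsCompact μ₁.support) :
    -- the objects are well defined: `OT_A` is finite and `π_A` is its only solution
    (∀ A : EGW.Mat d₀ d₁, EGW.eotValue ε μ₀ μ₁ A ≠ ⊥ ∧ EGW.eotValue ε μ₀ μ₁ A ≠ ⊤ ∧
      ∀ π, EGW.IsEOTOptimal ε μ₀ μ₁ A π ↔ π = EGW.eotCoupling ε μ₀ μ₁ A) ∧
    -- (i)
    ((∀ A : EGW.Mat d₀ d₁, EGW.IsStationaryPoint (EGW.Phi ε μ₀ μ₁) A ↔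
        A = (1 / 2 : ℝ) • EGW.crossMoment (EGW.eotCoupling ε μ₀ μ₁ A)) ∧
      Filter.Tendsto (EGW.Phi ε μ₀ μ₁) (Bornology.cobounded (EGW.Mat d₀ d₁)) Filter.atTop ∧
      (∀ A : EGW.Mat d₀ d₁, EGW.IsMinimizer (EGW.Phi ε μ₀ μ₁) A →
        EGW.IsStationaryPoint (EGW.Phi ε μ₀ μ₁) A) ∧
      (∀ A : EGW.Mat d₀ d₁, EGW.IsStationaryPoint (EGW.Phi ε μ₀ μ₁) A →
        A ∈ EGW.ballD d₀ d₁ √(EGW.secondMoment μ₀ * EGW.secondMoment μ₁))) ∧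
    -- (ii)
    (EGW.Centered μ₀ → EGW.Centered μ₁ → ∀ A : EGW.Mat d₀ d₁,
      EGW.IsMinimizer (EGW.Phi ε μ₀ μ₁) A ↔
        EGW.IsEGWOptimal ε μ₀ μ₁ (EGW.eotCoupling ε μ₀ μ₁ A) ∧
          (1 / 2 : ℝ) • EGW.crossMoment (EGW.eotCoupling ε μ₀ μ₁ A) = A) ∧
    -- (iii)
    (EGW.Centered μ₀ → EGW.Centered μ₁ →
      (∀ π, EGW.IsEGWOptimal ε μ₀ μ₁ π → (∀ π', EGW.IsEGWOptimal ε μ₀ μ₁ π' → π' = π) →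
        ∃ A : EGW.Mat d₀ d₁, EGW.IsMinimizer (EGW.Phi ε μ₀ μ₁) A ∧
          (∀ B, EGW.IsMinimizer (EGW.Phi ε μ₀ μ₁) B → B = A) ∧
          π = EGW.eotCoupling ε μ₀ μ₁ A) ∧
      (∀ A : EGW.Mat d₀ d₁, EGW.IsMinimizer (EGW.Phi ε μ₀ μ₁) A →
        (∀ B, EGW.IsMinimizer (EGW.Phi ε μ₀ μ₁) B → B = A) →
        EGW.IsEGWOptimal ε μ₀ μ₁ (EGW.eotCoupling ε μ₀ μ₁ A) ∧
          ∀ π, EGW.IsEGWOptimal ε μ₀ μ₁ π → π = EGW.eotCoupling ε μ₀ μ₁ A)) := by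
  obtain ⟨R₀, hR₀⟩ := EGW.exists_ae_norm_le_of_isCompact_support hμ₀
  obtain ⟨R₁, hR₁⟩ := EGW.exists_ae_norm_le_of_isCompact_support hμ₁
  have h₀ : ∀ᵐ x ∂μ₀, ‖x‖ ≤ max R₀ R₁ := hR₀.mono fun x hx ↦ hx.trans (le_max_left _ _)
  have h₁ : ∀ᵐ y ∂μ₁, ‖y‖ ≤ max R₀ R₁ := hR₁.mono fun x hx ↦ hx.trans (le_max_right _ _)
  obtain ⟨κ, hg⟩ := EGW.exists_hasGrowth hε h₀ h₁
  refine ⟨fun A ↦ ⟨?_, ?_, hg.isEOTOptimal_iff hε A⟩,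
    ⟨hg.isStationaryPoint_iff hε h₀ h₁, hg.tendsto_Phi_cobounded hε h₀ h₁,
      fun A ↦ hg.isStationaryPoint_of_isMinimizer hε h₀ h₁,
      fun A ↦ hg.mem_ballD_of_isStationaryPoint hε h₀ h₁⟩,
    fun hc₀ hc₁ A ↦ ?_, fun hc₀ hc₁ ↦ ?_⟩
  · rw [hg.eotValue_eq hε]
    exact EReal.coe_ne_bot _
  · rw [hg.eotValue_eq hε]
    exact EReal.coe_ne_top _
  · rw [EGW.isEGWOptimal_iff hε h₀ h₁ hc₀ hc₁]
    exact hg.isMinimizer_iff hε h₀ h₁ A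
  · simp only [EGW.isEGWOptimal_iff hε h₀ h₁ hc₀ hc₁]
    constructor
    · rintro π ⟨hπ, hmin⟩ huniq
      refine ⟨_, hg.isMinimizer_half_crossMoment hε h₀ h₁ hπ hmin, fun B hB ↦ ?_,
        hg.eotCoupling_half_crossMoment hε h₀ h₁ hπ hmin⟩
      obtain ⟨hB', he⟩ := (hg.isMinimizer_iff hε h₀ h₁ B).1 hB
      -- `π_B` is EGW-optimal, hence equals `π`, and `B` is half its own cross-moment.
      rw [← huniq _ hB', he]
    · intro A hA huniq
      refine ⟨((hg.isMinimizer_iff hε h₀ h₁ A).1 hA).1, fun π hπ ↦ ?_⟩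
      -- Any optimal `π` yields the minimizer `C(π) / 2`, which must be `A`; then `π = π_A`.
      have hB := huniq _ (hg.isMinimizer_half_crossMoment hε h₀ h₁ hπ.1 hπ.2)
      have he := hg.eotCoupling_half_crossMoment hε h₀ h₁ hπ.1 hπ.2
      rwa [hB] at he
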